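/- Let $p>2$ be a prime, $\mathbb F$ a finite field of characteristic $p$, and $A$ a commutative compact (Hausdorff) topological $\mathbb F$-algebra which is semi-local and such that $\mathbb F\to A/\mathfrak m$ is surjective for every maximal ideal $\mathfrak m$ of $A$. Let $\Pi$ be a profinite group such that the maximal pro-$p$ quotient of every open subgroup of $\Pi$ is topologically finitely generated. For every maximal ideal $\mathfrak m$ of $A$ let $\bar\rho_{\mathfrak m}:\Pi\to \mathrm{GL}_2(\mathbb F)$ be a continuous representation which is absolutely irreducible or conjugate to the sum of two distinct characters $\Pi\to\mathbb F^*$. Let $t:\Pi\to A$ be a continuous map and $d:\Pi\to A^*$ a continuous homomorphism such that $(t,d)$ is a two-dimensional pseudo-representation, i.e. $t(xy)=t(yx)$, $t(1)=2$ and $t(xy)+d(y)t(xy^{-1})=t(x)t(y)$ for all $x,y\in\Pi$. Assume that $(\Pi,\bar\rho,t,d)$ is an admissible pseudo-deformation: $t\equiv\operatorname{tr}\bar\rho_{\mathfrak m}$ and $d\equiv\det\bar\rho_{\mathfrak m}\pmod{\mathfrak m}$ for every $\mathfrak m$; $d(g)$ lies in the image of $\mathbb F$ in $A$ for all $g\in\Pi$;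 and the $\mathbb F$-subalgebra of $A$ generated by $t(\Pi)$ is dense in $A$. Let $\rho:\Pi\to R^*$ be a $(t,d)$-representation. That is, $R=\begin{pmatrix}A&B\\ C&A\end{pmatrix}$ is a generalized matrix algebra, where $B,C$ are $A$-modules with a bilinear map $B\times C\to A$, $(b,c)\mapsto bc$, such that $(bc)b'=(b'c)b$ and $(bc')c=(bc)c'$, and $R$ is multiplied by the usual rule for matrices; $R$ is faithful, i.e. $y=0$ is the only $y\in R$ with $\det y=0$ and $\operatorname{tr}(yx)=0$ for all $x\in R$; and $\rho$ is a homomorphism with $\operatorname{tr}\rho=t$, $\det\rho=d$ whose image spans $R$ as an $A$-module. Give $R$ its $A$-module topology, let $\operatorname{rad}R$ be its Jacobson radical, and put $G=\rho(\Pi)$ and $\bar G=$ the image of $G$ in $(R/\operatorname{rad}R)^*$. Let $\Gamma$ be the group of the $g\in G$ with $\det g=1$ and $g-1\in\operatorname{rad}R$; let $L$ be the closure of the additive subgroup of $R$ generated by the elements $\gamma-\tfrac12\operatorname{tr}(\gamma)\,\mathrm{Id}$, $\gamma\in\Gamma$, and let $L_2$ be the closure of the additive subgroup generated by the commutators $xy-yx$,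 $x,y\in L$. Let $S$ be the set of the $g\in G$ such that $\operatorname{tr} g=0$ and $-\det g$ is the square of an element of $A^*$, and let $$A_{\mathrm{ess}}=\sum_{g\in S}\mathbb F\operatorname{tr}(gL_2)\subset A .$$ Assume that $(\Pi,\bar\rho,t,d)$ is weakly odd, i.e. $S\neq\emptyset$. Let $l:A\to\mathbb F$ be an $\mathbb F$-linear form that is not identically $0$ on $A_{\mathrm{ess}}$. Then $\bar G$ is finite and, with $n=|\bar G|$, $$\mu_\Pi\bigl(\{g\in\Pi: l(t(g))\neq0\}\bigr)\ \ge\ \frac{p-1}{pn},$$ where $\mu_\Pi$ is the Haar measure on $\Pi$ of total mass $1$ (understood as the outer measure if $l$ is not continuous and the set is not measurable). -/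

import Mathlib

open MeasureTheory TopologicalSpace

noncomputable section

/-! ### Profinite groups and the `p`-finiteness condition -/

/-- The kernel of the projection of a topological group `H` onto its maximal pro-`p` quotient:
the intersection of all open normal subgroups of `H` whose index is a power of `p`. -/
def maxProPKernel (p : ℕ) (H : Type*) [Group H] [TopologicalSpace H] : Subgroup H :=
  sInf {U : Subgroup H | U.Normal ∧ IsOpen (U : Set H) ∧ ∃ k : ℕ, U.index = p ^ k}

instance maxProPKernel_normal (p : ℕ) (H : Type*) [Group H] [TopologicalSpace H] :
    (maxProPKernel p H).Normal := by
  constructor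
  intro x hx g
  rw [maxProPKernel, Subgroup.mem_sInf] at hx ⊢
  intro U hU
  exact hU.1.conj_mem x (hx U hU) g

/-- A topological group is topologically finitely generated if some finitely generated subgroup
is dense. -/
def TopologicallyFG (H : Type*) [Group H] [TopologicalSpace H] : Prop :=
  ∃ s : Set H, s.Finite ∧ Dense (Subgroup.closure s : Set H)

/-- Mazur's finiteness condition at `p`: the maximal pro-`p` quotient of every open subgroup is
topologically finitely generated. -/
def PFinitenessCondition (p : ℕ) (PG : Type*) [Group PG] [TopologicalSpace PG] : Prop :=
  ∀ H : Subgroup PG, IsOpen (H : Set PG) → TopologicallyFG (H ⧸ maxProPKernel p H)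

/-! ### Residual representations -/

/-- The representation on column vectors defined by a homomorphism to `GL₂(K)`. -/
def vectorRep {PG K : Type*} [Group PG] [Field K] (r : PG →* GL (Fin 2) K) :
    Representation K PG (Fin 2 → K) :=
  ((Matrix.toLinAlgEquiv' : Matrix (Fin 2) (Fin 2) K ≃ₐ[K] _) : _ →* _).comp
    ((Units.coeHom (Matrix (Fin 2) (Fin 2) K)).comp r)

/-- Absolute irreducibility: irreducibility over an algebraic closure. -/
def IsAbsolutelyIrreducible {PG F : Type*} [Group PG] [Field F] (r : PG →* GL (Fin 2) F) : Prop :=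
  (vectorRep ((Matrix.GeneralLinearGroup.map (algebraMap F (AlgebraicClosure F))).comp
    r)).IsIrreducible

/-- `r` is conjugate to the direct sum of two distinct characters with values in `Fˣ`. -/
def IsSumOfTwoDistinctCharacters {PG F : Type*} [Group PG] [Field F]
    (r : PG →* GL (Fin 2) F) : Prop :=
  ∃ χ₁ χ₂ : PG →* Fˣ, χ₁ ≠ χ₂ ∧ ∃ P : GL (Fin 2) F, ∀ g : PG,
    (r g : Matrix (Fin 2) (Fin 2) F) * P = P * Matrix.diagonal ![(χ₁ g : F), (χ₂ g : F)]

/-! ### Pseudo-representations of dimension two -/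

/-- Two-dimensional pseudo-representations of a group with values in a commutative ring. -/
structure IsPseudoRep {PG A : Type*} [Group PG] [CommRing A] (t : PG → A) (d : PG →* Aˣ) : Prop where
  central : ∀ x y, t (x * y) = t (y * x)
  map_one : t 1 = 2
  identity : ∀ x y, t (x * y) + d y * t (x * y⁻¹) = t x * t y

/-! ### Generalized matrix algebras -/

/-- The data defining a generalized matrix algebra (of type `(1,1)`) over `A`: a bilinear map
`m : B × C → A` with the two conditions that make matrix multiplication associative. -/
structure GMA (A B C : Type*) [CommRing A] [AddCommGroup B] [Module A B] [AddCommGroup C]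
    [Module A C] where
  m : B →ₗ[A] C →ₗ[A] A
  assoc_left : ∀ b b' c, m b c • b' = m b' c • b
  assoc_right : ∀ b c c', m b c' • c = m b c • c'

namespace GMA

variable {A B C : Type*} [CommRing A] [AddCommGroup B] [Module A B] [AddCommGroup C] [Module A C]

/-- The underlying module of the algebra `R = A ⊕ B ⊕ C ⊕ A`; the quadruple `(a, b, c, d)` stands
for the matrix with rows `(a, b)` and `(c, d)`. -/
def Alg (_ : GMA A B C) : Type _ := A × B × C × A

variable (R : GMA A B C)

instance : AddCommGroup R.Alg := inferInstanceAs (AddCommGroup (A × B × C × A))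

instance : Module A R.Alg := inferInstanceAs (Module A (A × B × C × A))

variable {R}

/-- The matrix with rows `(a, b)` and `(c, d)`. -/
def ofEntries (a : A) (b : B) (c : C) (d : A) : R.Alg := (a, b, c, d)

/-- The upper left entry. -/
def e₁₁ (x : R.Alg) : A := Prod.fst x

/-- The upper right entry. -/
def e₁₂ (x : R.Alg) : B := (Prod.snd x).1

/-- The lower left entry. -/
def e₂₁ (x : R.Alg) : C := (Prod.snd x).2.1

/-- The lower right entry. -/
def e₂₂ (x : R.Alg) : A := (Prod.snd x).2.2

theorem alg_ext {x y : R.Alg} (h₁ : e₁₁ x = e₁₁ y) (h₂ : e₁₂ x = e₁₂ y) (h₃ : e₂₁ x = e₂₁ y)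
    (h₄ : e₂₂ x = e₂₂ y) : x = y :=
  Prod.ext h₁ (Prod.ext h₂ (Prod.ext h₃ h₄))

instance : Mul R.Alg :=
  ⟨fun x y => ofEntries (e₁₁ x * e₁₁ y + R.m (e₁₂ x) (e₂₁ y)) (e₁₁ x • e₁₂ y + e₂₂ y • e₁₂ x)
    (e₁₁ y • e₂₁ x + e₂₂ x • e₂₁ y) (e₂₂ x * e₂₂ y + R.m (e₁₂ y) (e₂₁ x))⟩

instance : One R.Alg := ⟨ofEntries 1 0 0 1⟩

section Entries

variable (x y : R.Alg) (r : A)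

theorem e₁₁_mul : e₁₁ (x * y) = e₁₁ x * e₁₁ y + R.m (e₁₂ x) (e₂₁ y) := rfl
theorem e₁₂_mul : e₁₂ (x * y) = e₁₁ x • e₁₂ y + e₂₂ y • e₁₂ x := rfl
theorem e₂₁_mul : e₂₁ (x * y) = e₁₁ y • e₂₁ x + e₂₂ x • e₂₁ y := rfl
theorem e₂₂_mul : e₂₂ (x * y) = e₂₂ x * e₂₂ y + R.m (e₁₂ y) (e₂₁ x) := rfl
theorem e₁₁_one : e₁₁ (1 : R.Alg) = 1 := rfl
theorem e₁₂_one : e₁₂ (1 : R.Alg) = 0 := rfl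
theorem e₂₁_one : e₂₁ (1 : R.Alg) = 0 := rfl
theorem e₂₂_one : e₂₂ (1 : R.Alg) = 1 := rfl
theorem e₁₁_add : e₁₁ (x + y) = e₁₁ x + e₁₁ y := rfl
theorem e₁₂_add : e₁₂ (x + y) = e₁₂ x + e₁₂ y := rfl
theorem e₂₁_add : e₂₁ (x + y) = e₂₁ x + e₂₁ y := rfl
theorem e₂₂_add : e₂₂ (x + y) = e₂₂ x + e₂₂ y := rfl
theorem e₁₁_zero : e₁₁ (0 : R.Alg) = 0 := rfl
theorem e₁₂_zero : e₁₂ (0 : R.Alg) = 0 := rfl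
theorem e₂₁_zero : e₂₁ (0 : R.Alg) = 0 := rfl
theorem e₂₂_zero : e₂₂ (0 : R.Alg) = 0 := rfl
theorem e₁₁_smul : e₁₁ (r • x) = r * e₁₁ x := rfl
theorem e₁₂_smul : e₁₂ (r • x) = r • e₁₂ x := rfl
theorem e₂₁_smul : e₂₁ (r • x) = r • e₂₁ x := rfl
theorem e₂₂_smul : e₂₂ (r • x) = r * e₂₂ x := rfl

end Entries

protected theorem mul_assoc (x y z : R.Alg) : x * y * z = x * (y * z) := by
  apply alg_ext
  · simp only [e₁₁_mul, e₁₂_mul, e₂₁_mul, map_add, map_smul, LinearMap.add_apply,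
      LinearMap.smul_apply, smul_eq_mul]
    ring
  · simp only [e₁₁_mul, e₁₂_mul, e₂₂_mul, smul_add, add_smul, smul_smul,
      R.assoc_left (e₁₂ x) (e₁₂ z) (e₂₁ y)]
    module
  · simp only [e₁₁_mul, e₂₁_mul, e₂₂_mul, smul_add, add_smul, smul_smul,
      R.assoc_right (e₁₂ y) (e₂₁ x) (e₂₁ z)]
    module
  · simp only [e₁₂_mul, e₂₁_mul, e₂₂_mul, map_add, map_smul, LinearMap.add_apply,
      LinearMap.smul_apply, smul_eq_mul]
    ring

instance : Ring R.Alg :=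
  { (inferInstance : AddCommGroup R.Alg), (inferInstance : Mul R.Alg),
    (inferInstance : One R.Alg) with
    mul_assoc := GMA.mul_assoc
    one_mul := fun x => by
      apply alg_ext <;>
        simp [e₁₁_mul, e₁₂_mul, e₂₁_mul, e₂₂_mul, e₁₁_one, e₁₂_one, e₂₁_one, e₂₂_one]
    mul_one := fun x => by
      apply alg_ext <;>
        simp [e₁₁_mul, e₁₂_mul, e₂₁_mul, e₂₂_mul, e₁₁_one, e₁₂_one, e₂₁_one, e₂₂_one]
    zero_mul := fun x => by
      apply alg_ext <;>
        simp [e₁₁_mul, e₁₂_mul, e₂₁_mul, e₂₂_mul, e₁₁_zero, e₁₂_zero, e₂₁_zero, e₂₂_zero]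
    mul_zero := fun x => by
      apply alg_ext <;>
        simp [e₁₁_mul, e₁₂_mul, e₂₁_mul, e₂₂_mul, e₁₁_zero, e₁₂_zero, e₂₁_zero, e₂₂_zero]
    left_distrib := fun x y z => by
      apply alg_ext <;>
        simp only [e₁₁_mul, e₁₂_mul, e₂₁_mul, e₂₂_mul, e₁₁_add, e₁₂_add, e₂₁_add, e₂₂_add,
          map_add, LinearMap.add_apply, smul_add, add_smul, mul_add] <;> abel
    right_distrib := fun x y z => by
      apply alg_ext <;>
        simp only [e₁₁_mul, e₁₂_mul, e₂₁_mul, e₂₂_mul, e₁₁_add, e₁₂_add, e₂₁_add, e₂₂_add,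
          map_add, LinearMap.add_apply, smul_add, add_smul, add_mul] <;> abel }

instance : Algebra A R.Alg :=
  Algebra.ofModule
    (fun r x y => by
      apply alg_ext <;>
        simp only [e₁₁_mul, e₁₂_mul, e₂₁_mul, e₂₂_mul, e₁₁_smul, e₁₂_smul, e₂₁_smul, e₂₂_smul,
          map_smul, LinearMap.smul_apply, smul_eq_mul, smul_add, smul_smul] <;>
        first
          | ring1
          | module)
    (fun r x y => by
      apply alg_ext <;>
        simp only [e₁₁_mul, e₁₂_mul, e₂₁_mul, e₂₂_mul, e₁₁_smul, e₁₂_smul, e₂₁_smul, e₂₂_smul,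
          map_smul, LinearMap.smul_apply, smul_eq_mul, smul_add, smul_smul] <;>
        first
          | ring1
          | module)

/-- The natural topology of the `A`-algebra `R`: its `A`-module topology. For `R` finite over a
compact ring `A` this is the quotient topology of any surjection `Aⁿ → R`. -/
instance [TopologicalSpace A] : TopologicalSpace R.Alg := moduleTopology A R.Alg

/-- The trace `a + d`. -/
def tr (x : R.Alg) : A := e₁₁ x + e₂₂ x

/-- The determinant `ad - bc`. -/
def det (x : R.Alg) : A := e₁₁ x * e₂₂ x - R.m (e₁₂ x) (e₂₁ x)

variable (R)

/-- `R` is faithful: the kernel of the pseudo-representation `(tr, det)` is zero. -/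
def IsFaithful : Prop :=
  ∀ y : R.Alg, det y = 0 → (∀ x : R.Alg, tr (y * x) = 0) → y = 0

/-- `SR¹`: the units of determinant `1` in `1 + rad R`, where `rad R` is the Jacobson radical. -/
def SR₁ : Set R.Algˣ :=
  {u | det (u : R.Alg) = 1 ∧ (u : R.Alg) - 1 ∈ Ring.jacobson R.Alg}

end GMA

/-- `ρ` is a `(t,d)`-representation: a homomorphism to the units of a faithful generalized matrix
algebra over `A` with trace `t` and determinant `d`, whose image generates the algebra as an
`A`-module. -/
structure IsTDRep {PG A B C : Type*} [Group PG] [CommRing A] [AddCommGroup B] [Module A B]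
    [AddCommGroup C] [Module A C] (t : PG → A) (d : PG →* Aˣ) (R : GMA A B C)
    (ρ : PG →* R.Algˣ) : Prop where
  faithful : R.IsFaithful
  tr_eq : ∀ g, GMA.tr (ρ g : R.Alg) = t g
  det_eq : ∀ g, GMA.det (ρ g : R.Alg) = d g
  span_eq_top : Submodule.span A (Set.range fun g => (ρ g : R.Alg)) = ⊤

/-! ### Admissible pseudo-deformations -/

/-- The `F`-algebra `A` is semi-local and all its residue fields are equal to `F`. -/
structure IsSemilocalWithResidueField (F A : Type*) [Field F] [CommRing A] [Algebra F A] :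
    Prop where
  semilocal : Finite (MaximalSpectrum A)
  residue : ∀ 𝔪 : MaximalSpectrum A,
    Function.Surjective ((Ideal.Quotient.mk 𝔪.asIdeal).comp (algebraMap F A))

/-- `(PG, ρbar, t, d)` is an admissible pseudo-deformation over the `F`-algebra `A`. The residual
representations are indexed by the maximal ideals of `A`. Since `A` is an `F`-algebra, the constants
of `A`, i.e. the Teichmüller lifts of elements of `F`, are the elements of the image of `F`. -/
structure IsAdmissiblePseudoDeformation (p : ℕ) {PG F A : Type*} [Group PG] [TopologicalSpace PG]
    [Field F] [TopologicalSpace F] [CommRing A] [TopologicalSpace A]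
    [Algebra F A] (ρbar : MaximalSpectrum A → (PG →* GL (Fin 2) F)) (t : PG → A) (d : PG →* Aˣ) :
    Prop where
  pFinite : PFinitenessCondition p PG
  residual_continuous : ∀ 𝔪, Continuous (ρbar 𝔪)
  residual_multiplicityFree : ∀ 𝔪,
    IsAbsolutelyIrreducible (ρbar 𝔪) ∨ IsSumOfTwoDistinctCharacters (ρbar 𝔪)
  pseudoRep : IsPseudoRep t d
  continuous_t : Continuous t
  continuous_d : Continuous fun g => (d g : A)
  deform_t : ∀ (𝔪 : MaximalSpectrum A) (g : PG),
    t g - algebraMap F A (Matrix.trace (ρbar 𝔪 g : Matrix (Fin 2) (Fin 2) F)) ∈ 𝔪.asIdeal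
  deform_d : ∀ (𝔪 : MaximalSpectrum A) (g : PG),
    (d g : A) - algebraMap F A (Matrix.det (ρbar 𝔪 g : Matrix (Fin 2) (Fin 2) F)) ∈ 𝔪.asIdeal
  constant_det : ∀ g, (d g : A) ∈ Set.range (algebraMap F A)
  generated : Dense (Algebra.adjoin F (Set.range t) : Set A)

/-! ### The essential submodule -/

namespace GMA

variable {PG F A B C : Type*} [Group PG] [Field F] [CommRing A] [Algebra F A] [AddCommGroup B]
  [Module A B] [AddCommGroup C] [Module A C] {R : GMA A B C}

/-- The subgroup `Ḡ` of `(R / rad R)ˣ`, image of the group `G = ρ(PG)`. -/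
def residualImage (ρ : PG →* R.Algˣ) : Subgroup (R.Alg ⧸ Ring.jacobson R.Alg)ˣ :=
  ρ.range.map (Units.map (Ideal.Quotient.mk (Ring.jacobson R.Alg)).toMonoidHom)

variable (F) in
/-- Pink's map `Θ(x) = x - (tr x / 2) Id`; the scalar `1/2` is taken in the field `F`. -/
def pinkTheta (x : R.Alg) : R.Alg := x - ((2⁻¹ : F) • tr x) • (1 : R.Alg)

/-- The closure of the additive subgroup of `R` generated by `X`. -/
def closedAddSpan [TopologicalSpace A] (X : Set R.Alg) : Set R.Alg :=
  closure (AddSubgroup.closure X : Set R.Alg)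

variable (F) in
/-- Pink's Lie algebra `L` of the group `ρ(PG) ∩ SR¹`: the closure of the additive subgroup
generated by its image under `Θ`. -/
def pinkLie [TopologicalSpace A] (ρ : PG →* R.Algˣ) : Set R.Alg :=
  closedAddSpan ((fun u : R.Algˣ => pinkTheta F (u : R.Alg)) '' ((ρ.range : Set R.Algˣ) ∩ R.SR₁))

variable (F) in
/-- The derived Lie algebra `L₂ = [L, L]`: the closure of the additive subgroup generated by the
commutators of elements of `L`. -/
def pinkLie₂ [TopologicalSpace A] (ρ : PG →* R.Algˣ) : Set R.Alg :=
  closedAddSpan {z | ∃ x ∈ pinkLie F ρ, ∃ y ∈ pinkLie F ρ, z = x * y - y * x}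

/-- The set `S` of the `g ∈ G = ρ(PG)` with `tr g = 0` such that `-det g` is a square in `Aˣ`. -/
def oddSet (ρ : PG →* R.Algˣ) : Set R.Algˣ :=
  {g | g ∈ ρ.range ∧ tr (g : R.Alg) = 0 ∧ ∃ a : Aˣ, -det (g : R.Alg) = (a : A) ^ 2}

/-- Weak oddness: the set `S` is nonempty. -/
def IsWeaklyOdd (ρ : PG →* R.Algˣ) : Prop := (oddSet ρ).Nonempty

variable (F) in
/-- The essential submodule `A_ess = ∑_{g ∈ S} F tr(g L₂)`. -/
def essentialSubmodule [TopologicalSpace A] (ρ : PG →* R.Algˣ) : Submodule F A :=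
  Submodule.span F {a | ∃ g ∈ oddSet ρ, ∃ x ∈ pinkLie₂ F ρ, a = tr ((g : R.Alg) * x)}

end GMA

end

/-! Let `N` be the kernel of the residual map `PG → Ḡ`, an open subgroup of measure `1/n`. Some
`g₀ ∈ S` and `x ∈ L₂` satisfy `l (tr (g₀ x)) ≠ 0`. Let `M ⊆ N` be a compact set on which
`g ↦ l (t (g₀ g))` vanishes. As `tr g₀ = 0`, the form `l (tr (g₀ ·))` vanishes on `Θ(M)`, while
its value `k · l (tr (g₀ x))` at `k x` is nonzero for `0 < k < p`. So the translates of `Θ(M)` by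
`k x`, `0 ≤ k < p`, are disjoint. By compactness they stay disjoint modulo `{y | tr (R y) ⊆ I}` for
a small open ideal `I` of `A`, and the quotient of `R` by this two-sided ideal is finite. There
Pink's theory shows that `Θ` is injective on the image of `N` and that its values are stable under
translation by `L₂`. Counting gives `p μ(M) ≤ μ(N)`, hence
`μ {g ∈ N | l (t (g₀ g)) ≠ 0} ≥ (1 - 1/p) μ(N)`, and translating by `g₀` concludes.

Open ideals form a basis of neighbourhoods of zero in `A` because compact groups of finite exponent
have small open subgroups: by Bogolyubov's lemma a dense subset `S` of a finite group of bounded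
exponent has the property that `S - S + S - S` contains a subgroup of bounded index, and because
the bound depends only on the density and the exponent, it passes to infinite groups. -/

/-! ### Compact rings of positive characteristic -/

section Bogolyubov

open Finset

variable {E : Type*} [AddCommGroup E]

theorem exists_addMonoidHom_rootsOfUnity_of_card_le {n : ℕ} [NeZero n] (hn : ∀ x : E, n • x = 0)
    {X : Finset (AddChar E ℂ)} {N : ℕ} (hX : #X ≤ N) :
    ∃ f : E →+ (Fin N → Additive (rootsOfUnity n ℂ)), ∀ x, f x = 0 → ∀ χ ∈ X, χ x = 1 := by
  have hpow (χ : AddChar E ℂ) (x : E) : χ x ^ n = 1 := by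
    rw [← AddChar.map_nsmul_eq_pow, hn, AddChar.map_zero_eq_one]
  obtain ⟨e⟩ : Nonempty (X ↪ Fin N) :=
    Function.Embedding.nonempty_of_card_le (by simpa using hX)
  let χ : Fin N → AddChar E ℂ := Function.extend e Subtype.val 1
  refine ⟨AddMonoidHom.mk' (fun x i => Additive.ofMul (rootsOfUnity.mkOfPowEq (χ i x) (hpow _ x)))
    fun x y => ?_, fun x hx ψ hψ => ?_⟩
  · ext i
    simp [AddChar.map_add_eq_mul]
  · have h := congrArg (fun z : Additive (rootsOfUnity n ℂ) => ((z.toMul : ℂˣ) : ℂ))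
      (congrFun hx (e ⟨ψ, hψ⟩))
    simpa [χ, e.injective.extend_apply] using h

/-- The unnormalized Fourier coefficient at `χ` of the indicator function of `S`. -/
noncomputable def charSum (S : Finset E) (χ : AddChar E ℂ) : ℂ := ∑ s ∈ S, χ s

theorem norm_sq_charSum [Finite E] (S : Finset E) (χ : AddChar E ℂ) :
    ((‖charSum S χ‖ ^ 2 : ℝ) : ℂ) = ∑ a ∈ S, ∑ b ∈ S, χ (a - b) := by
  rw [← Complex.normSq_eq_norm_sq, ← Complex.mul_conj, charSum, map_sum, sum_mul_sum]
  simp only [← AddChar.map_neg_eq_conj, ← AddChar.map_add_eq_mul, sub_eq_add_neg]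

theorem sum_norm_pow_four_charSum_mul_eq_zero [Finite E] {S : Finset E} {x : E}
    (hx : ∀ a ∈ S, ∀ b ∈ S, ∀ c ∈ S, ∀ d ∈ S, (a - b) + (c - d) + x ≠ 0) :
    ∑ χ : AddChar E ℂ, ((‖charSum S χ‖ ^ 4 : ℝ) : ℂ) * χ x = 0 := by
  classical
  have := Fintype.ofFinite E
  have expand (χ : AddChar E ℂ) : ((‖charSum S χ‖ ^ 4 : ℝ) : ℂ) * χ x
      = ∑ q ∈ (S ×ˢ S) ×ˢ (S ×ˢ S), χ ((q.1.1 - q.1.2) + (q.2.1 - q.2.2) + x) := by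
    rw [show ‖charSum S χ‖ ^ 4 = ‖charSum S χ‖ ^ 2 * ‖charSum S χ‖ ^ 2 by ring,
      Complex.ofReal_mul, norm_sq_charSum, ← sum_product', sum_mul_sum, ← sum_product', sum_mul]
    simp only [AddChar.map_add_eq_mul]
  simp_rw [expand]
  rw [sum_comm]
  refine sum_eq_zero fun q hq => ?_
  simp only [mem_product] at hq
  rw [AddChar.sum_apply_eq_ite, if_neg (hx _ hq.1.1 _ hq.1.2 _ hq.2.1 _ hq.2.2)]

variable [Fintype E]

theorem sum_norm_sq_charSum (S : Finset E) :
    ∑ χ : AddChar E ℂ, ‖charSum S χ‖ ^ 2 = (Fintype.card E : ℝ) * #S := by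
  classical
  suffices ∑ χ : AddChar E ℂ, ((‖charSum S χ‖ ^ 2 : ℝ) : ℂ) = (Fintype.card E : ℂ) * #S by
    exact_mod_cast this
  have orthogonality (a : E) (ha : a ∈ S) :
      ∑ χ : AddChar E ℂ, ∑ b ∈ S, χ (a - b) = Fintype.card E := by
    rw [sum_comm]
    simp [AddChar.sum_apply_eq_ite, sub_eq_zero, ha]
  simp_rw [norm_sq_charSum]
  rw [sum_comm, sum_congr rfl orthogonality, sum_const, nsmul_eq_mul, mul_comm]

theorem mem_of_forall_large_charSum {S : Finset E} (hS : S.Nonempty) {θ : ℝ} (hθ : 0 ≤ θ)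
    (hθS : θ * Fintype.card E < (#S : ℝ) ^ 3) {x : E}
    (hx : ∀ χ : AddChar E ℂ, θ ≤ ‖charSum S χ‖ ^ 2 → χ x = 1) :
    ∃ a ∈ S, ∃ b ∈ S, ∃ c ∈ S, ∃ d ∈ S, x = (a - b) + (c - d) := by
  classical
  by_contra! hcon
  have sum_eq_zero : ∑ χ : AddChar E ℂ, ‖charSum S χ‖ ^ 4 * (χ x).re = 0 := by
    have h := congrArg Complex.re (sum_norm_pow_four_charSum_mul_eq_zero (S := S) (x := x)
      fun a ha b hb c hc d hd h => hcon b hb a ha d hd c hc (by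
        rw [eq_neg_of_add_eq_zero_right h]; abel))
    simpa only [Complex.re_sum, Complex.re_ofReal_mul, Complex.zero_re] using h
  have pointwise (χ : AddChar E ℂ) :
      (if χ = 0 then (#S : ℝ) ^ 4 else 0) - θ * ‖charSum S χ‖ ^ 2
        ≤ ‖charSum S χ‖ ^ 4 * (χ x).re := by
    split_ifs with hχ
    · subst hχ
      simpa [charSum] using mul_nonneg hθ (sq_nonneg (#S : ℝ))
    by_cases hlarge : θ ≤ ‖charSum S χ‖ ^ 2
    · rw [hx χ hlarge, Complex.one_re]
      nlinarith [mul_nonneg hθ (sq_nonneg ‖charSum S χ‖), sq_nonneg (‖charSum S χ‖ ^ 2)]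
    · have hre : -1 ≤ (χ x).re := by
        simpa only [AddChar.norm_apply] using (abs_le.1 (Complex.abs_re_le_norm (χ x))).1
      nlinarith [mul_le_mul_of_nonneg_left hre (sq_nonneg (‖charSum S χ‖ ^ 2)),
        mul_le_mul_of_nonneg_right (not_le.1 hlarge).le (sq_nonneg ‖charSum S χ‖)]
  have h := sum_le_sum fun χ (_ : χ ∈ univ) => pointwise χ
  rw [sum_eq_zero, sum_sub_distrib, ← mul_sum, sum_norm_sq_charSum, sum_ite_eq',
    if_pos (mem_univ _)] at h
  have hSpos : (0 : ℝ) < #S := mod_cast hS.card_pos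
  nlinarith [mul_lt_mul_of_pos_right hθS hSpos]

theorem card_large_charSum_mul_le (S : Finset E) (θ : ℝ) :
    (#{χ : AddChar E ℂ | θ ≤ ‖charSum S χ‖ ^ 2} : ℝ) * θ ≤ Fintype.card E * #S := by
  rw [← sum_norm_sq_charSum, ← nsmul_eq_mul, ← sum_const]
  refine (sum_le_sum fun χ hχ => (mem_filter.1 hχ).2).trans ?_
  exact sum_le_sum_of_subset_of_nonneg (filter_subset _ _) fun _ _ _ => by positivity

theorem card_large_charSum_le {S : Finset E} (hS : S.Nonempty) {m : ℕ}
    (hm : Fintype.card E ≤ m * #S) :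
    #{χ : AddChar E ℂ | (#S : ℝ) ^ 3 / (2 * Fintype.card E) ≤ ‖charSum S χ‖ ^ 2} ≤ 2 * m ^ 2 := by
  have _ : (0 : ℝ) < #S := mod_cast hS.card_pos
  have _ : (0 : ℝ) < Fintype.card E := mod_cast Fintype.card_pos
  have hm' : (Fintype.card E : ℝ) ≤ m * #S := mod_cast hm
  have h := card_large_charSum_mul_le S ((#S : ℝ) ^ 3 / (2 * Fintype.card E))
  set k := #{χ : AddChar E ℂ | (#S : ℝ) ^ 3 / (2 * Fintype.card E) ≤ ‖charSum S χ‖ ^ 2}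
  suffices (k : ℝ) * (#S : ℝ) ^ 3 ≤ 2 * m ^ 2 * (#S : ℝ) ^ 3 by
    exact_mod_cast le_of_mul_le_mul_right this (by positivity)
  calc (k : ℝ) * (#S : ℝ) ^ 3
      = k * ((#S : ℝ) ^ 3 / (2 * Fintype.card E)) * (2 * Fintype.card E) := by field_simp
    _ ≤ (Fintype.card E : ℝ) * #S * (2 * Fintype.card E) := by gcongr
    _ = 2 * (Fintype.card E : ℝ) ^ 2 * #S := by ring
    _ ≤ 2 * (m * #S) ^ 2 * #S := by gcongr
    _ = 2 * m ^ 2 * (#S : ℝ) ^ 3 := by ring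

theorem bogolyubov_exists_addMonoidHom {n : ℕ} [NeZero n] (hn : ∀ x : E, n • x = 0)
    {S : Finset E} (hS : S.Nonempty) {m : ℕ} (hm : Fintype.card E ≤ m * #S) :
    ∃ f : E →+ (Fin (2 * m ^ 2) → Additive (rootsOfUnity n ℂ)), ∀ x, f x = 0 →
      ∃ a ∈ S, ∃ b ∈ S, ∃ c ∈ S, ∃ d ∈ S, x = (a - b) + (c - d) := by
  obtain ⟨f, hf⟩ := exists_addMonoidHom_rootsOfUnity_of_card_le hn (card_large_charSum_le hS hm)
  have _ : (0 : ℝ) < #S := mod_cast hS.card_pos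
  have _ : (0 : ℝ) < Fintype.card E := mod_cast Fintype.card_pos
  refine ⟨f, fun x hx => mem_of_forall_large_charSum hS
    (θ := (#S : ℝ) ^ 3 / (2 * Fintype.card E)) (by positivity) ?_ fun χ hχ => hf x hx χ (by simpa)⟩
  rw [show (#S : ℝ) ^ 3 / (2 * Fintype.card E) * Fintype.card E = (#S : ℝ) ^ 3 / 2 by field_simp]
  exact half_lt_self (by positivity)

end Bogolyubov

section CompactExponent

open Finset

theorem exists_addMonoidHom_ker_subset_of_forall_finset {M H : Type*} [AddCommGroup M]
    [AddGroup H] [Finite H] {V : Set M}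
    (h : ∀ s : Finset M, ∃ f : M → H, (∀ x ∈ s, ∀ y ∈ s, f (x + y) = f x + f y) ∧
      ∀ x ∈ s, f x = 0 → x ∈ V) :
    ∃ f : M →+ H, (f.ker : Set M) ⊆ V := by
  classical
  choose g hadd hV using h
  obtain ⟨f, hf⟩ := Finset.rado_selection g
  refine ⟨AddMonoidHom.mk' f fun x y => ?_, fun x hx => ?_⟩
  · obtain ⟨s, hs, hfs⟩ := hf {x, y, x + y}
    rw [hfs _ (by simp), hfs x (by simp), hfs y (by simp)]
    exact hadd s x (hs (by simp)) y (hs (by simp))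
  · obtain ⟨s, hs, hfs⟩ := hf {x}
    exact hV s x (hs (by simp)) ((hfs x (by simp)).symm.trans hx)

theorem finite_closure_of_nsmul_eq_zero {M : Type*} [AddCommGroup M] {n : ℕ} [NeZero n]
    (hn : ∀ x : M, n • x = 0) (s : Finset M) : Finite (AddSubgroup.closure (s : Set M)) :=
  AddCommGroup.finite_of_fg_isAddTorsion _ fun x =>
    isOfFinAddOrder_iff_nsmul_eq_zero.2 ⟨n, NeZero.pos n, Subtype.ext (hn x)⟩

theorem card_le_mul_card_of_forall_exists_sub_mem {E : Type*} [AddGroup E] [Fintype E]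
    {S t : Finset E} (h : ∀ x, ∃ e ∈ t, x - e ∈ S) : Fintype.card E ≤ #t * #S := by
  classical
  calc Fintype.card E = #(univ : Finset E) := rfl
    _ ≤ #((t ×ˢ S).image fun z => z.2 + z.1) := card_le_card fun x _ => by
        obtain ⟨e, he, hxe⟩ := h x
        exact mem_image.2 ⟨(e, x - e), mk_mem_product he hxe, sub_add_cancel x e⟩
    _ ≤ #t * #S := card_image_le.trans_eq (card_product _ _)

variable {M : Type*} [AddCommGroup M] [TopologicalSpace M] [IsTopologicalAddGroup M]

theorem exists_nhds_zero_sub_add_sub_mem {V : Set M} (hV : V ∈ nhds (0 : M)) :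
    ∃ U ∈ nhds (0 : M), ∀ a ∈ U, ∀ b ∈ U, ∀ c ∈ U, ∀ d ∈ U, (a - b) + (c - d) ∈ V := by
  obtain ⟨V₂, hV₂, hadd⟩ := exists_nhds_zero_half hV
  obtain ⟨U, hU, hsub⟩ := exists_nhds_half_neg hV₂
  exact ⟨U, hU, fun a ha b hb c hc d hd => hadd _ (hsub a ha b hb) _ (hsub c hc d hd)⟩

variable [CompactSpace M]

theorem exists_finset_forall_exists_sub_mem {U : Set M} (hU : U ∈ nhds (0 : M)) :
    ∃ s : Finset M, ∀ x, ∃ e ∈ s, x - e ∈ U := by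
  obtain ⟨s, -, hs⟩ := isCompact_univ.elim_nhds_subcover (fun e : M => (fun x => x - e) ⁻¹' U)
    fun e _ => (continuous_id.sub continuous_const).continuousAt.preimage_mem_nhds
      (by simpa using hU)
  exact ⟨s, fun x => by simpa using hs (Set.mem_univ x)⟩

theorem exists_addMonoidHom_finite_ker_subset {n : ℕ} [NeZero n] (hn : ∀ x : M, n • x = 0)
    {V : Set M} (hV : V ∈ nhds (0 : M)) :
    ∃ (N : ℕ) (f : M →+ (Fin N → Additive (rootsOfUnity n ℂ))), (f.ker : Set M) ⊆ V := by
  classical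
  obtain ⟨U, hU, hUV⟩ := exists_nhds_zero_sub_add_sub_mem hV
  obtain ⟨t, ht⟩ := exists_finset_forall_exists_sub_mem hU
  refine ⟨_, exists_addMonoidHom_ker_subset_of_forall_finset
    (H := Fin (2 * #t ^ 2) → Additive (rootsOfUnity n ℂ)) fun s => ?_⟩
  let E := AddSubgroup.closure (↑(s ∪ t) : Set M)
  have hsE : ∀ x ∈ s, x ∈ E := fun x hx => AddSubgroup.subset_closure (by simp [hx])
  have htE : ∀ x ∈ t, x ∈ E := fun x hx => AddSubgroup.subset_closure (by simp [hx])
  have : Finite E := finite_closure_of_nsmul_eq_zero hn _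
  let _ : Fintype E := Fintype.ofFinite E
  let S : Finset E := {x | (x : M) ∈ U}
  have hcover (x : E) : ∃ e ∈ t.subtype (· ∈ E), x - e ∈ S := by
    obtain ⟨e, he, hxe⟩ := ht x
    exact ⟨⟨e, htE e he⟩, by simpa using he, by simpa [S] using hxe⟩
  have hcard : Fintype.card E ≤ #t * #S :=
    (card_le_mul_card_of_forall_exists_sub_mem hcover).trans <| Nat.mul_le_mul_right _ <| by
      rw [card_subtype]
      exact card_filter_le _ _
  have hS : S.Nonempty := ⟨0, by simpa [S] using mem_of_mem_nhds hU⟩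
  obtain ⟨f, hf⟩ := bogolyubov_exists_addMonoidHom (fun x : E => Subtype.ext (hn x)) hS hcard
  have hfV (x : E) (hx : f x = 0) : (x : M) ∈ V := by
    obtain ⟨a, ha, b, hb, c, hc, d, hd, rfl⟩ := hf x hx
    simp only [S, mem_filter_univ] at ha hb hc hd
    exact hUV a ha b hb c hc d hd
  refine ⟨fun x => if hx : x ∈ E then f ⟨x, hx⟩ else 0, fun x hx y hy => ?_, fun x hx hfx => ?_⟩
  · simp only [hsE x hx, hsE y hy, E.add_mem (hsE x hx) (hsE y hy), dif_pos, ← map_add]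
    rfl
  · exact hfV ⟨x, hsE x hx⟩ (by simpa [hsE x hx] using hfx)

theorem exists_isOpen_addSubgroup_subset {n : ℕ} [NeZero n] (hn : ∀ x : M, n • x = 0)
    {V : Set M} (hV : V ∈ nhds (0 : M)) :
    ∃ W : AddSubgroup M, IsOpen (W : Set M) ∧ (W : Set M) ⊆ V := by
  obtain ⟨V', hV', hV'closed, hV'V⟩ := exists_mem_nhds_isClosed_subset hV
  obtain ⟨N, f, hf⟩ := exists_addMonoidHom_finite_ker_subset hn hV'
  have hker : f.ker.FiniteIndex := inferInstance
  have hclosure : f.ker.topologicalClosure.FiniteIndex :=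
    AddSubgroup.finiteIndex_of_le f.ker.le_topologicalClosure
  exact ⟨f.ker.topologicalClosure, AddSubgroup.isOpen_of_isClosed_of_finiteIndex _
    f.ker.isClosed_topologicalClosure, (closure_minimal hf hV'closed).trans hV'V⟩

end CompactExponent

section CompactRing

variable {A : Type*} [CommRing A] [TopologicalSpace A] [IsTopologicalRing A] [CompactSpace A]

theorem exists_isOpen_ideal_le_addSubgroup {W : AddSubgroup A} (hW : IsOpen (W : Set A)) :
    ∃ I : Ideal A, IsOpen (I : Set A) ∧ (I : Set A) ⊆ W := by
  let I : Ideal A :=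
    { carrier := {x | ∀ a, a * x ∈ W}
      zero_mem' := fun a => by simp
      add_mem' := fun hx hy a => by rw [mul_add]; exact W.add_mem (hx a) (hy a)
      smul_mem' := fun c x hx a => by rw [smul_eq_mul, ← mul_assoc]; exact hx _ }
  have hmem : ∀ᶠ x in nhds (0 : A), ∀ a ∈ Set.univ, a * x ∈ W :=
    isCompact_univ.eventually_forall_of_forall_eventually fun a _ =>
      (hW.preimage (continuous_snd.mul continuous_fst)).mem_nhds (by simp)
  refine ⟨I, AddSubgroup.isOpen_of_mem_nhds I.toAddSubgroup (g := 0) ?_, fun x hx => ?_⟩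
  · filter_upwards [hmem] with x hx a using hx a trivial
  · simpa using hx 1

theorem exists_isOpen_ideal_subset {n : ℕ} [NeZero n] [CharP A n] {V : Set A}
    (hV : V ∈ nhds (0 : A)) : ∃ I : Ideal A, IsOpen (I : Set A) ∧ (I : Set A) ⊆ V := by
  obtain ⟨W, hWo, hWV⟩ := exists_isOpen_addSubgroup_subset (n := n) (by simp) hV
  obtain ⟨I, hIo, hIW⟩ := exists_isOpen_ideal_le_addSubgroup hWo
  exact ⟨I, hIo, hIW.trans hWV⟩

theorem exists_isOpen_ideal_notMem [T1Space A] {n : ℕ} [NeZero n] [CharP A n] {a : A}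
    (ha : a ≠ 0) : ∃ I : Ideal A, IsOpen (I : Set A) ∧ a ∉ I := by
  obtain ⟨I, hIo, hI⟩ := exists_isOpen_ideal_subset (n := n) (isOpen_ne.mem_nhds ha.symm)
  exact ⟨I, hIo, fun haI => hI haI rfl⟩

theorem isClosed_setOf_isUnit [T2Space A] : IsClosed {a : A | IsUnit a} := by
  have h : {a : A | IsUnit a} = Prod.fst '' {x : A × A | x.1 * x.2 = 1} := by
    ext a
    simp [isUnit_iff_exists_inv]
  rw [h]
  exact ((isClosed_eq (by fun_prop) continuous_const).isCompact.image continuous_fst).isClosed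

theorem isOpen_of_isMaximal [T2Space A] [Finite (MaximalSpectrum A)] (m : Ideal A)
    [hm : m.IsMaximal] : IsOpen (m : Set A) := by
  classical
  obtain ⟨a, ha⟩ := Ideal.exists_forall_sub_mem_ideal (I := MaximalSpectrum.asIdeal (R := A))
    (fun _ _ h => MaximalSpectrum.isCoprime_of_ne h) (fun n => if n.asIdeal = m then 1 else 0)
  have ham : a - 1 ∈ m := by simpa using ha ⟨m, hm⟩
  have han (n : Ideal A) (hn : n.IsMaximal) (hne : n ≠ m) : a ∈ n := by
    simpa [hne] using ha ⟨n, hn⟩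
  have mem_iff (x : A) : x ∈ m ↔ ¬IsUnit (a * x - (a - 1)) := by
    refine ⟨fun hx hu => hm.ne_top (m.eq_top_of_isUnit_mem ?_ hu), fun hu => ?_⟩
    · exact m.sub_mem (m.mul_mem_left a hx) ham
    obtain ⟨n, hn, hxn⟩ := exists_max_ideal_of_mem_nonunits hu
    obtain rfl : n = m := by
      by_contra hne
      refine hn.ne_top (n.eq_top_of_isUnit_mem ?_ isUnit_one)
      simpa using n.add_mem (n.sub_mem hxn (n.mul_mem_right x (han n hn hne))) (han n hn hne)
    have h := Ideal.sub_mem _ (Ideal.add_mem _ hxn ham) (Ideal.mul_mem_right x _ ham)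
    ring_nf at h
    exact h
  have h : (m : Set A) = (fun x => a * x - (a - 1)) ⁻¹' {a : A | IsUnit a}ᶜ :=
    Set.ext mem_iff
  rw [h]
  exact isClosed_setOf_isUnit.isOpen_compl.preimage (by fun_prop)

theorem isOpen_jacobson [T2Space A] [Finite (MaximalSpectrum A)] :
    IsOpen (Ring.jacobson A : Set A) := by
  rw [Ring.jacobson_eq_sInf_isMaximal, ← MaximalSpectrum.range_asIdeal, sInf_range,
    Submodule.coe_iInf]
  exact isOpen_iInter_of_finite fun m => isOpen_of_isMaximal m.asIdeal

end CompactRing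

/-! ### Pink's theory -/

section ClosureLemmas

variable {Q : Type*} [Ring Q]

theorem map₂_mem_of_mem_closure (f : Q →+ Q →+ Q) {s t : Set Q} {N : AddSubgroup Q}
    (h : ∀ x ∈ s, ∀ y ∈ t, f x y ∈ N) {x y : Q} (hx : x ∈ AddSubgroup.closure s)
    (hy : y ∈ AddSubgroup.closure t) : f x y ∈ N := by
  have hsy : ∀ x ∈ s, f x y ∈ N := fun x hx =>
    (AddSubgroup.closure_le (N.comap (f x))).2 (h x hx) hy
  exact (AddSubgroup.closure_le (N.comap (f.flip y))).2 hsy hx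

theorem lie_mem_of_mem_closure {s t : Set Q} {N : AddSubgroup Q}
    (h : ∀ x ∈ s, ∀ y ∈ t, ⁅x, y⁆ ∈ N) {x y : Q} (hx : x ∈ AddSubgroup.closure s)
    (hy : y ∈ AddSubgroup.closure t) : ⁅x, y⁆ ∈ N :=
  map₂_mem_of_mem_closure (AddMonoidHom.mul - AddMonoidHom.mul.flip) h hx hy

theorem mul_mem_of_mem_closure {s : Set Q} {N : AddSubgroup Q} {c : Q}
    (h : ∀ z ∈ s, c * z ∈ N) {z : Q} (hz : z ∈ AddSubgroup.closure s) : c * z ∈ N :=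
  (AddSubgroup.closure_le (N.comap (AddMonoidHom.mulLeft c))).2 h hz

theorem mem_of_two_mul_mem {k : ℕ} (hk : (2 * k : Q) = 1) {M : AddSubgroup Q} {x : Q}
    (hx : 2 * x ∈ M) : x ∈ M := by
  have hkx : k • (2 * x) = x := by
    rw [nsmul_eq_mul, ← mul_assoc, (Nat.cast_commute k (2 : Q)).eq, hk, one_mul]
  exact hkx ▸ M.nsmul_mem hx k

theorem mem_of_two_pow_mul_mem {k : ℕ} (hk : (2 * k : Q) = 1) {M : AddSubgroup Q}
    (n : ℕ) {x : Q} (hx : 2 ^ n * x ∈ M) : x ∈ M := by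
  induction n with
  | zero => simpa only [pow_zero, one_mul] using hx
  | succ n ih => exact ih (mem_of_two_mul_mem hk (by rwa [← mul_assoc, ← pow_succ']))

theorem mul_mem_of_sq_add_four_mul_mem {k : ℕ} (hk : (2 * k : Q) = 1) {M : AddSubgroup Q}
    {σ w : Q} (hσ : IsNilpotent σ) (hM : ∀ z ∈ M, σ * z ∈ M) (hw : (σ * σ + 4 * σ) * w ∈ M) :
    σ * w ∈ M := by
  obtain ⟨N, hN⟩ := hσ
  have hpow (j : ℕ) : ∀ z ∈ M, σ ^ j * z ∈ M := by
    induction j with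
    | zero => simp only [pow_zero, one_mul, imp_self, implies_true]
    | succ j ih => exact fun z hz => by rw [pow_succ, mul_assoc]; exact ih _ (hM z hz)
  -- `4 σʲ⁺¹ w ≡ -σʲ⁺² w` modulo `M`, and high powers of `σ` vanish: descend on the exponent.
  have hdescent (d : ℕ) : ∀ j, N ≤ j + d → σ ^ (j + 1) * w ∈ M := by
    induction d with
    | zero =>
      intro j hj
      rw [pow_eq_zero_of_le (by omega) hN, zero_mul]
      exact M.zero_mem
    | succ d ih =>
      intro j hj
      refine mem_of_two_pow_mul_mem hk 2 ?_
      have hrec : 2 ^ 2 * (σ ^ (j + 1) * w) =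
          σ ^ j * ((σ * σ + 4 * σ) * w) - σ ^ (j + 1 + 1) * w := by
        rw [pow_succ σ (j + 1), pow_succ σ j]
        noncomm_ring
      exact hrec ▸ M.sub_mem (hpow j _ hw) (ih (j + 1) (by omega))
  simpa only [zero_add, pow_one] using hdescent N 0 (by omega)

end ClosureLemmas

section Identities

variable {Q : Type*} [Ring Q]

/-- The odd part of a unit with respect to `u ↦ u⁻¹`. For determinant one `2 × 2` matrices it is
twice the trace-free part `u - ½ tr(u)`. -/
def oddPart (u : Qˣ) : Q := ↑u - ↑u⁻¹

/-- The even part of a unit with respect to `u ↦ u⁻¹`. For determinant one `2 × 2` matrices it is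
the scalar `tr(u)`. -/
def evenPart (u : Qˣ) : Q := ↑u + ↑u⁻¹

/-- The anticommutator (Jordan product, without the factor `½`) of two ring elements. -/
def anticomm (x y : Q) : Q := x * y + y * x

theorem anticomm_comm (x y : Q) : anticomm x y = anticomm y x := add_comm _ _

theorem oddPart_inv (u : Qˣ) : oddPart u⁻¹ = -oddPart u := by
  rw [oddPart, oddPart, inv_inv, neg_sub]

theorem evenPart_add_oddPart (u : Qˣ) : evenPart u + oddPart u = 2 * u := by
  rw [evenPart, oddPart]
  noncomm_ring

theorem evenPart_sub_oddPart (u : Qˣ) : evenPart u - oddPart u = 2 * ↑u⁻¹ := by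
  rw [evenPart, oddPart]
  noncomm_ring

theorem anticomm_oddPart (u v : Qˣ) : anticomm (oddPart u) (oddPart v) =
    evenPart (u * v) + evenPart (v * u) - evenPart (u * v⁻¹) - evenPart (u⁻¹ * v) := by
  simp only [anticomm, oddPart, evenPart, mul_inv_rev, inv_inv, Units.val_mul]
  noncomm_ring

theorem lie_oddPart (u v : Qˣ) : ⁅oddPart u, oddPart v⁆ =
    oddPart (u * v) - oddPart (v * u) - oddPart (u * v⁻¹) - oddPart (u⁻¹ * v) := by
  simp only [Ring.lie_def, oddPart, mul_inv_rev, inv_inv, Units.val_mul]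
  noncomm_ring

theorem evenPart_mul_oddPart {u : Qˣ} (hu : evenPart u ∈ Subring.center Q) (v : Qˣ) :
    evenPart u * oddPart v = oddPart (v * u) + oddPart (v * u⁻¹) := by
  rw [oddPart, mul_sub, ← Subring.mem_center_iff.1 hu v]
  simp only [evenPart, oddPart, mul_inv_rev, inv_inv, Units.val_mul]
  noncomm_ring

theorem evenPart_mul_self (u : Qˣ) : evenPart u * evenPart u = oddPart u * oddPart u + 4 := by
  have hexpand : evenPart u * evenPart u =
      oddPart u * oddPart u + 2 * (u * ↑u⁻¹) + 2 * (↑u⁻¹ * u) := by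
    simp only [evenPart, oddPart]
    noncomm_ring
  rw [hexpand, u.mul_inv, u.inv_mul, add_assoc]
  norm_num

theorem evenPart_sub_two_mul_self_add (u : Qˣ) :
    (evenPart u - 2) * (evenPart u - 2) + 4 * (evenPart u - 2) = oddPart u * oddPart u := by
  have hexpand : (evenPart u - 2) * (evenPart u - 2) + 4 * (evenPart u - 2) =
      evenPart u * evenPart u - 4 := by
    noncomm_ring
    norm_num
  rw [hexpand, evenPart_mul_self, add_sub_cancel_right]

theorem four_mul_oddPart_mul {u v : Qˣ} (hu : evenPart u ∈ Subring.center Q)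
    (hv : evenPart v ∈ Subring.center Q) :
    4 * oddPart (u * v) = ⁅oddPart u, oddPart v⁆ + 2 * (evenPart u * oddPart v)
      + 2 * (evenPart v * oddPart u) := by
  have hexpand : 4 * oddPart (u * v) = ⁅oddPart u, oddPart v⁆ + oddPart u * evenPart v
      + evenPart u * oddPart v + evenPart v * oddPart u + oddPart v * evenPart u
      + (evenPart u * evenPart v - evenPart v * evenPart u) := by
    simp only [Ring.lie_def, oddPart, evenPart, mul_inv_rev, Units.val_mul]
    noncomm_ring
  rw [hexpand, Subring.mem_center_iff.1 hv, Subring.mem_center_iff.1 hv,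
    Subring.mem_center_iff.1 hu]
  noncomm_ring

theorem lie_lie_eq_anticomm {x y z : Q} (hxy : anticomm x y ∈ Subring.center Q)
    (hxz : anticomm x z ∈ Subring.center Q) :
    ⁅x, ⁅y, z⁆⁆ = 2 * (anticomm x y * z - anticomm x z * y) := by
  have hexpand : ⁅x, ⁅y, z⁆⁆ =
      anticomm x y * z + z * anticomm x y - y * anticomm x z - anticomm x z * y := by
    simp only [Ring.lie_def, anticomm]
    noncomm_ring
  rw [hexpand, Subring.mem_center_iff.1 hxy, Subring.mem_center_iff.1 hxz]
  noncomm_ring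

theorem anticomm_lie_swap {x y : Q} (h : anticomm x y ∈ Subring.center Q) (z : Q) :
    anticomm x ⁅y, z⁆ = -anticomm y ⁅x, z⁆ := by
  rw [eq_neg_iff_add_eq_zero, ← sub_eq_zero.2 (Subring.mem_center_iff.1 h z).symm]
  simp only [Ring.lie_def, anticomm]
  noncomm_ring

theorem four_mul_lie_mul {y : Q} (hy : anticomm y y ∈ Subring.center Q) (x : Q) :
    4 * (⁅x, y⁆ * y) = -(2 * ⁅y, ⁅x, y⁆⁆) := by
  rw [eq_neg_iff_add_eq_zero, ← sub_eq_zero.2 (Subring.mem_center_iff.1 hy x)]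
  simp only [Ring.lie_def, anticomm]
  noncomm_ring

theorem four_mul_lie_units {u v : Qˣ} (hu : evenPart u ∈ Subring.center Q)
    (hv : evenPart v ∈ Subring.center Q) : 4 * ⁅(u : Q), (v : Q)⁆ = ⁅oddPart u, oddPart v⁆ := by
  have hu' (q : Q) : ⁅evenPart u, q⁆ = 0 := sub_eq_zero.2 (Subring.mem_center_iff.1 hu q).symm
  have hv' (q : Q) : ⁅q, evenPart v⁆ = 0 := sub_eq_zero.2 (Subring.mem_center_iff.1 hv q)
  calc 4 * ⁅(u : Q), (v : Q)⁆ = ⁅evenPart u + oddPart u, evenPart v + oddPart v⁆ := by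
        rw [evenPart_add_oddPart, evenPart_add_oddPart]
        simp only [Ring.lie_def]
        noncomm_ring
    _ = ⁅oddPart u, oddPart v⁆ + ⁅evenPart u, evenPart v + oddPart v⁆
          + ⁅oddPart u, evenPart v⁆ := by
        simp only [Ring.lie_def]
        noncomm_ring
    _ = ⁅oddPart u, oddPart v⁆ := by rw [hu', hv', add_zero, add_zero]

theorem four_mul_anticomm_inv {u v : Qˣ} (hu : evenPart u ∈ Subring.center Q)
    (hv : evenPart v ∈ Subring.center Q) :
    4 * anticomm (↑u⁻¹ : Q) ↑v⁻¹ = 2 * (evenPart u * evenPart v)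
      - 2 * (evenPart u * oddPart v) - 2 * (evenPart v * oddPart u)
      + anticomm (oddPart u) (oddPart v) := by
  calc 4 * anticomm (↑u⁻¹ : Q) ↑v⁻¹ =
        anticomm (evenPart u - oddPart u) (evenPart v - oddPart v) := by
        rw [evenPart_sub_oddPart, evenPart_sub_oddPart]
        simp only [anticomm]
        noncomm_ring
    _ = evenPart u * evenPart v + evenPart v * evenPart u - evenPart u * oddPart v
      - oddPart v * evenPart u - evenPart v * oddPart u - oddPart u * evenPart v
      + anticomm (oddPart u) (oddPart v) := by
        simp only [anticomm]
        noncomm_ring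
    _ = _ := by
        rw [Subring.mem_center_iff.1 hu (evenPart v), Subring.mem_center_iff.1 hu (oddPart v),
          Subring.mem_center_iff.1 hv (oddPart u)]
        noncomm_ring

theorem oddPart_commutator (u v : Qˣ) :
    oddPart (u * v * u⁻¹ * v⁻¹) = ⁅(u : Q), (v : Q)⁆ * anticomm (↑u⁻¹ : Q) ↑v⁻¹ := by
  have hexpand : ⁅(u : Q), (v : Q)⁆ * anticomm (↑u⁻¹ : Q) ↑v⁻¹ =
      ↑(u * v * u⁻¹ * v⁻¹) + ↑(u * v * (v⁻¹ * u⁻¹)) - ↑(v * u * (u⁻¹ * v⁻¹))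
        - ↑(v * u * v⁻¹ * u⁻¹) := by
    simp only [Ring.lie_def, anticomm, Units.val_mul]
    noncomm_ring
  rw [hexpand, oddPart, ← mul_inv_rev, mul_inv_cancel, ← mul_inv_rev, mul_inv_cancel,
    add_sub_cancel_right]
  simp only [mul_inv_rev, inv_inv, mul_assoc]

theorem thirtyTwo_mul_oddPart_commutator {u v : Qˣ} (hu : evenPart u ∈ Subring.center Q)
    (hv : evenPart v ∈ Subring.center Q)
    (huv : anticomm (oddPart u) (oddPart v) ∈ Subring.center Q)
    (huu : anticomm (oddPart u) (oddPart u) ∈ Subring.center Q)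
    (hvv : anticomm (oddPart v) (oddPart v) ∈ Subring.center Q) :
    32 * oddPart (u * v * u⁻¹ * v⁻¹) =
      4 * (evenPart u * (evenPart v * ⁅oddPart u, oddPart v⁆))
      + 2 * (anticomm (oddPart u) (oddPart v) * ⁅oddPart u, oddPart v⁆)
      + 2 * (evenPart u * ⁅oddPart v, ⁅oddPart u, oddPart v⁆⁆)
      + 2 * (evenPart v * ⁅oddPart u, ⁅oddPart u, oddPart v⁆⁆) := by
  have hWv := four_mul_lie_mul hvv (oddPart u)
  have hWu := four_mul_lie_mul huu (oddPart v)
  have hskew : ⁅oddPart v, oddPart u⁆ = -⁅oddPart u, oddPart v⁆ := (neg_sub _ _).symm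
  have hskew' (W : Q) : ⁅oddPart u, -W⁆ = -⁅oddPart u, W⁆ := by
    simp only [Ring.lie_def]
    noncomm_ring
  rw [hskew, hskew', neg_mul, mul_neg, mul_neg, neg_inj] at hWu
  have hsplit : 32 * oddPart (u * v * u⁻¹ * v⁻¹) =
      2 * ((4 * ⁅(u : Q), (v : Q)⁆) * (4 * anticomm (↑u⁻¹ : Q) ↑v⁻¹)) := by
    rw [oddPart_commutator]
    noncomm_ring
  rw [hsplit, four_mul_lie_units hu hv, four_mul_anticomm_inv hu hv]
  set W := ⁅oddPart u, oddPart v⁆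
  have hexpand : 2 * (W * (2 * (evenPart u * evenPart v) - 2 * (evenPart u * oddPart v)
      - 2 * (evenPart v * oddPart u) + anticomm (oddPart u) (oddPart v))) =
      4 * (W * evenPart u * evenPart v) + 2 * (W * anticomm (oddPart u) (oddPart v))
        - 4 * (W * evenPart u * oddPart v) - 4 * (W * evenPart v * oddPart u) := by
    noncomm_ring
  have hpull {a : Q} (ha : a ∈ Subring.center Q) (b : Q) :
      4 * (W * a * b) = a * (4 * (W * b)) := by
    rw [Subring.mem_center_iff.1 ha]
    noncomm_ring
  rw [hexpand, hpull hu (oddPart v), hpull hv, hWv, hWu, Subring.mem_center_iff.1 huv,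
    Subring.mem_center_iff.1 hu, mul_assoc, Subring.mem_center_iff.1 hv]
  noncomm_ring

end Identities

section LieSeries

variable {Q : Type*} [Ring Q]

/-- The descending central series `L₀ ⊇ L₁ ⊇ ⋯` of the Lie ring `L₀` spanned by the odd parts of
the elements of `Γ`, i.e. `Lₙ₊₁ = [L₀, Lₙ]`. The indices are those of Pink shifted by one. -/
def lieSeries (Γ : Subgroup Qˣ) : ℕ → AddSubgroup Q
  | 0 => AddSubgroup.closure (oddPart '' (Γ : Set Qˣ))
  | n + 1 => AddSubgroup.closure
      {z | ∃ x ∈ AddSubgroup.closure (oddPart '' (Γ : Set Qˣ)), ∃ y ∈ lieSeries Γ n, z = ⁅x, y⁆}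

variable {Γ : Subgroup Qˣ} {k : ℕ}

theorem oddPart_mem_lieSeries_zero {u : Qˣ} (hu : u ∈ Γ) : oddPart u ∈ lieSeries Γ 0 :=
  AddSubgroup.subset_closure ⟨u, hu, rfl⟩

theorem lie_mem_lieSeries {n : ℕ} {x y : Q} (hx : x ∈ lieSeries Γ 0) (hy : y ∈ lieSeries Γ n) :
    ⁅x, y⁆ ∈ lieSeries Γ (n + 1) :=
  AddSubgroup.subset_closure ⟨x, hx, y, hy, rfl⟩

theorem lieSeries_succ_le_iff {n : ℕ} {M : AddSubgroup Q} : lieSeries Γ (n + 1) ≤ M ↔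
    ∀ x ∈ lieSeries Γ 0, ∀ y ∈ lieSeries Γ n, ⁅x, y⁆ ∈ M := by
  refine ⟨fun h x hx y hy => h (lie_mem_lieSeries hx hy), fun h => (AddSubgroup.closure_le _).2 ?_⟩
  rintro _ ⟨x, hx, y, hy, rfl⟩
  exact h x hx y hy

theorem lie_mem_lieSeries_zero {x y : Q} (hx : x ∈ lieSeries Γ 0) (hy : y ∈ lieSeries Γ 0) :
    ⁅x, y⁆ ∈ lieSeries Γ 0 := by
  refine lie_mem_of_mem_closure ?_ hx hy
  rintro _ ⟨u, hu, rfl⟩ _ ⟨v, hv, rfl⟩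
  have hodd {w : Qˣ} (hw : w ∈ Γ) := oddPart_mem_lieSeries_zero hw
  rw [lie_oddPart]
  exact sub_mem (sub_mem (sub_mem (hodd (mul_mem hu hv)) (hodd (mul_mem hv hu)))
    (hodd (mul_mem hu (inv_mem hv)))) (hodd (mul_mem (inv_mem hu) hv))

theorem lieSeries_succ_le (n : ℕ) : lieSeries Γ (n + 1) ≤ lieSeries Γ n := by
  induction n with
  | zero => exact lieSeries_succ_le_iff.2 fun x hx y hy => lie_mem_lieSeries_zero hx hy
  | succ n ih => exact lieSeries_succ_le_iff.2 fun x hx y hy => lie_mem_lieSeries hx (ih hy)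

theorem lieSeries_antitone : Antitone (lieSeries Γ) := antitone_nat_of_succ_le lieSeries_succ_le

theorem mul_mem_lieSeries_add {c : Q} (hc : c ∈ Subring.center Q) {m n : ℕ}
    (h : ∀ z ∈ lieSeries Γ m, c * z ∈ lieSeries Γ n) (j : ℕ) :
    ∀ z ∈ lieSeries Γ (m + j), c * z ∈ lieSeries Γ (n + j) := by
  induction j with
  | zero => exact h
  | succ j ih =>
    refine (lieSeries_succ_le_iff (M := (lieSeries Γ (n + (j + 1))).comap
      (AddMonoidHom.mulLeft c))).2 fun x hx y hy => ?_
    have hlie : c * ⁅x, y⁆ = ⁅x, c * y⁆ := by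
      simp only [Ring.lie_def, mul_sub, ← mul_assoc, Subring.mem_center_iff.1 hc x]
    change c * ⁅x, y⁆ ∈ lieSeries Γ (n + (j + 1))
    exact hlie ▸ lie_mem_lieSeries hx (ih y hy)

/-- The additive group of the central elements of `Q` which multiply the Lie ring `lieSeries Γ 0`
into itself. -/
def centralMultiplier (Γ : Subgroup Qˣ) : AddSubgroup Q where
  carrier := {c | c ∈ Subring.center Q ∧ ∀ z ∈ lieSeries Γ 0, c * z ∈ lieSeries Γ 0}
  zero_mem' := ⟨zero_mem _, fun z _ => by rw [zero_mul]; exact zero_mem _⟩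
  add_mem' := fun hc hd => ⟨add_mem hc.1 hd.1, fun z hz => by
    rw [add_mul]; exact add_mem (hc.2 z hz) (hd.2 z hz)⟩
  neg_mem' := fun hc => ⟨neg_mem hc.1, fun z hz => by rw [neg_mul]; exact neg_mem (hc.2 z hz)⟩

theorem mul_mem_lieSeries {c : Q} (hc : c ∈ centralMultiplier Γ) {n : ℕ} {z : Q}
    (hz : z ∈ lieSeries Γ n) : c * z ∈ lieSeries Γ n := by
  have := mul_mem_lieSeries_add hc.1 hc.2 n
  rw [zero_add] at this
  exact this z hz

theorem evenPart_mem_centralMultiplier (hΓ : ∀ u ∈ Γ, evenPart u ∈ Subring.center Q) {u : Qˣ}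
    (hu : u ∈ Γ) : evenPart u ∈ centralMultiplier Γ := by
  refine ⟨hΓ u hu, fun z hz => mul_mem_of_mem_closure ?_ hz⟩
  rintro _ ⟨v, hv, rfl⟩
  rw [evenPart_mul_oddPart (hΓ u hu)]
  exact add_mem (oddPart_mem_lieSeries_zero (mul_mem hv hu))
    (oddPart_mem_lieSeries_zero (mul_mem hv (inv_mem hu)))

theorem anticomm_mem_centralMultiplier (hΓ : ∀ u ∈ Γ, evenPart u ∈ Subring.center Q) {x y : Q}
    (hx : x ∈ lieSeries Γ 0) (hy : y ∈ lieSeries Γ 0) : anticomm x y ∈ centralMultiplier Γ := by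
  refine map₂_mem_of_mem_closure (AddMonoidHom.mul + AddMonoidHom.mul.flip) ?_ hx hy
  rintro _ ⟨u, hu, rfl⟩ _ ⟨v, hv, rfl⟩
  have heven {w : Qˣ} (hw : w ∈ Γ) := evenPart_mem_centralMultiplier hΓ hw
  change anticomm (oddPart u) (oddPart v) ∈ _
  rw [anticomm_oddPart]
  exact sub_mem (sub_mem (add_mem (heven (mul_mem hu hv)) (heven (mul_mem hv hu)))
    (heven (mul_mem hu (inv_mem hv)))) (heven (mul_mem (inv_mem hu) hv))

theorem anticomm_mul_sub_mem (hΓ : ∀ u ∈ Γ, evenPart u ∈ Subring.center Q)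
    (hk : (2 * k : Q) = 1) {n : ℕ} {x y z : Q} (hx : x ∈ lieSeries Γ 0)
    (hy : y ∈ lieSeries Γ 0) (hz : z ∈ lieSeries Γ n) :
    anticomm x y * z - anticomm x z * y ∈ lieSeries Γ (n + 2) := by
  have hz0 : z ∈ lieSeries Γ 0 := lieSeries_antitone (Nat.zero_le n) hz
  refine mem_of_two_mul_mem hk ?_
  rw [← lie_lie_eq_anticomm (anticomm_mem_centralMultiplier hΓ hx hy).1
    (anticomm_mem_centralMultiplier hΓ hx hz0).1]
  exact lie_mem_lieSeries hx (lie_mem_lieSeries hy hz)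

theorem anticomm_lie_mul_sub_mem (hΓ : ∀ u ∈ Γ, evenPart u ∈ Subring.center Q)
    (hk : (2 * k : Q) = 1) {u v x y : Q} (hu : u ∈ lieSeries Γ 0) (hv : v ∈ lieSeries Γ 0)
    (hx : x ∈ lieSeries Γ 0) (hy : y ∈ lieSeries Γ 0) :
    anticomm u ⁅x, y⁆ * v - anticomm v ⁅x, y⁆ * u ∈ lieSeries Γ 2 := by
  have huv := anticomm_mul_sub_mem hΓ hk hu hv (lie_mem_lieSeries hx hy)
  have hvu := anticomm_mul_sub_mem hΓ hk hv hu (lie_mem_lieSeries hx hy)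
  rw [anticomm_comm v u] at hvu
  have h := lieSeries_succ_le 2 (sub_mem hvu huv)
  rwa [sub_sub_sub_cancel_left] at h

theorem anticomm_mul_lie_mem (hΓ : ∀ u ∈ Γ, evenPart u ∈ Subring.center Q)
    (hk : (2 * k : Q) = 1) {u v x y : Q} (hu : u ∈ lieSeries Γ 0) (hv : v ∈ lieSeries Γ 0)
    (hx : x ∈ lieSeries Γ 0) (hy : y ∈ lieSeries Γ 0) :
    anticomm u v * ⁅x, y⁆ ∈ lieSeries Γ 2 := by
  have hanti {a b : Q} (ha : a ∈ lieSeries Γ 0) (hb : b ∈ lieSeries Γ 0) :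
      anticomm a ⁅b, y⁆ = -anticomm b ⁅a, y⁆ :=
    anticomm_lie_swap (anticomm_mem_centralMultiplier hΓ ha hb).1 y
  -- Modulo `lieSeries Γ 2`, `anticomm a ⁅b, y⁆ * c` is skew in `a, b` and symmetric in `a, c`.
  have hxv := anticomm_lie_mul_sub_mem hΓ hk hx hv hu hy
  have hux := anticomm_lie_mul_sub_mem hΓ hk hu hx hv hy
  have hvu := anticomm_lie_mul_sub_mem hΓ hk hv hu hx hy
  rw [hanti hx hu, hanti hv hu] at hxv
  rw [hanti hx hv] at hux
  have hmem : anticomm u ⁅x, y⁆ * v ∈ lieSeries Γ 2 := by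
    refine mem_of_two_mul_mem hk ?_
    convert sub_mem (sub_mem hux hxv) hvu using 1
    noncomm_ring
  have huv := lieSeries_succ_le 2 (anticomm_mul_sub_mem hΓ hk hu hv (lie_mem_lieSeries hx hy))
  simpa only [sub_add_cancel] using add_mem huv hmem

theorem anticomm_mul_mem_lieSeries_succ (hΓ : ∀ u ∈ Γ, evenPart u ∈ Subring.center Q)
    (hk : (2 * k : Q) = 1) {u v : Q} (hu : u ∈ lieSeries Γ 0) (hv : v ∈ lieSeries Γ 0)
    {n : ℕ} {z : Q} (hz : z ∈ lieSeries Γ (n + 1)) :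
    anticomm u v * z ∈ lieSeries Γ (n + 2) := by
  have hone : lieSeries Γ 1 ≤ (lieSeries Γ 2).comap (AddMonoidHom.mulLeft (anticomm u v)) :=
    lieSeries_succ_le_iff.2 fun x hx y hy => anticomm_mul_lie_mem hΓ hk hu hv hx hy
  rw [add_comm n] at hz ⊢
  exact mul_mem_lieSeries_add (anticomm_mem_centralMultiplier hΓ hu hv).1 hone n z hz

theorem evenPart_sub_two_mul_mem (hΓ : ∀ u ∈ Γ, evenPart u ∈ Subring.center Q)
    (hk : (2 * k : Q) = 1) {u : Qˣ} (hu : u ∈ Γ) (hnil : IsNilpotent (evenPart u - 2))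
    {n : ℕ} {w : Q} (hw : anticomm (oddPart u) (oddPart u) * w ∈ lieSeries Γ n) :
    (evenPart u - 2) * w ∈ lieSeries Γ n := by
  refine mul_mem_of_sq_add_four_mul_mem hk hnil (fun z hz => ?_) ?_
  · rw [sub_mul, two_mul]
    exact sub_mem (mul_mem_lieSeries (evenPart_mem_centralMultiplier hΓ hu) hz) (add_mem hz hz)
  · refine mem_of_two_mul_mem hk ?_
    rwa [evenPart_sub_two_mul_self_add, ← mul_assoc, two_mul]

theorem evenPart_sub_two_mul_mem_succ (hΓ : ∀ u ∈ Γ, evenPart u ∈ Subring.center Q)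
    (hk : (2 * k : Q) = 1) {u : Qˣ} (hu : u ∈ Γ) (hnil : IsNilpotent (evenPart u - 2))
    {n : ℕ} {w : Q} (hw : w ∈ lieSeries Γ (n + 1)) :
    (evenPart u - 2) * w ∈ lieSeries Γ (n + 2) :=
  have hu0 := oddPart_mem_lieSeries_zero hu
  evenPart_sub_two_mul_mem hΓ hk hu hnil (anticomm_mul_mem_lieSeries_succ hΓ hk hu0 hu0 hw)

theorem oddPart_add_sub_oddPart_mul_mem (hΓ : ∀ u ∈ Γ, evenPart u ∈ Subring.center Q)
    (hk : (2 * k : Q) = 1) (hnil : ∀ u ∈ Γ, IsNilpotent (evenPart u - 2)) {u w : Qˣ} (hu : u ∈ Γ)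
    (hw : w ∈ Γ) {n : ℕ} (hwn : oddPart w ∈ lieSeries Γ (n + 1)) :
    oddPart u + oddPart w - oddPart (u * w) ∈ lieSeries Γ (n + 2) := by
  have hu0 := oddPart_mem_lieSeries_zero hu
  have hw0 := oddPart_mem_lieSeries_zero hw
  have hlie : ⁅oddPart u, oddPart w⁆ ∈ lieSeries Γ (n + 2) := lie_mem_lieSeries hu0 hwn
  have hevenu := evenPart_sub_two_mul_mem_succ hΓ hk hu (hnil u hu) hwn
  have hevenw : (evenPart w - 2) * oddPart u ∈ lieSeries Γ (n + 2) := by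
    refine evenPart_sub_two_mul_mem hΓ hk hw (hnil w hw) ?_
    have hswap := lieSeries_succ_le _ (anticomm_mul_sub_mem hΓ hk hw0 hu0 hwn)
    have := sub_mem (anticomm_mul_mem_lieSeries_succ hΓ hk hw0 hu0 hwn) hswap
    rwa [sub_sub_cancel] at this
  refine mem_of_two_pow_mul_mem hk 2 ?_
  have hfour : 2 ^ 2 * (oddPart u + oddPart w - oddPart (u * w)) =
      -(⁅oddPart u, oddPart w⁆ + (2 • ((evenPart u - 2) * oddPart w)
        + 2 • ((evenPart w - 2) * oddPart u))) := by
    have hdist : 2 ^ 2 * (oddPart u + oddPart w - oddPart (u * w)) =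
        4 * oddPart u + 4 * oddPart w - 4 * oddPart (u * w) := by noncomm_ring
    rw [hdist, four_mul_oddPart_mul (hΓ u hu) (hΓ w hw)]
    noncomm_ring
  rw [hfour]
  exact neg_mem (add_mem hlie (add_mem (nsmul_mem hevenu 2) (nsmul_mem hevenw 2)))

theorem two_mul_oddPart_commutator_sub_mem (hΓ : ∀ u ∈ Γ, evenPart u ∈ Subring.center Q)
    (hk : (2 * k : Q) = 1) (hnil : ∀ u ∈ Γ, IsNilpotent (evenPart u - 2)) {u v : Qˣ} (hu : u ∈ Γ)
    (hv : v ∈ Γ) {n : ℕ} (hvn : oddPart v ∈ lieSeries Γ n) :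
    2 * oddPart (u * v * u⁻¹ * v⁻¹) - ⁅oddPart u, oddPart v⁆ ∈ lieSeries Γ (n + 2) := by
  have hu0 := oddPart_mem_lieSeries_zero hu
  have hv0 := oddPart_mem_lieSeries_zero hv
  have heu := evenPart_mem_centralMultiplier hΓ hu
  have hev := evenPart_mem_centralMultiplier hΓ hv
  have hW : ⁅oddPart u, oddPart v⁆ ∈ lieSeries Γ (n + 1) := lie_mem_lieSeries hu0 hvn
  have hcomm := thirtyTwo_mul_oddPart_commutator heu.1 hev.1
    (anticomm_mem_centralMultiplier hΓ hu0 hv0).1 (anticomm_mem_centralMultiplier hΓ hu0 hu0).1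
    (anticomm_mem_centralMultiplier hΓ hv0 hv0).1
  set W := ⁅oddPart u, oddPart v⁆
  set w := oddPart (u * v * u⁻¹ * v⁻¹)
  have hexpand : 2 ^ 4 * (2 * w - W) = 4 • ((evenPart u - 2) * (evenPart v * W))
      + 8 • ((evenPart v - 2) * W) + 2 • (anticomm (oddPart u) (oddPart v) * W)
      + 2 • (evenPart u * ⁅oddPart v, W⁆) + 2 • (evenPart v * ⁅oddPart u, W⁆) := by
    have hdist : 2 ^ 4 * (2 * w - W) = 32 * w - 16 * W := by noncomm_ring
    rw [hdist, hcomm]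
    noncomm_ring
  refine mem_of_two_pow_mul_mem hk 4 (hexpand ▸ ?_)
  refine add_mem (add_mem (add_mem (add_mem ?_ ?_) ?_) ?_) ?_ <;> refine nsmul_mem ?_ _
  · exact evenPart_sub_two_mul_mem_succ hΓ hk hu (hnil u hu) (mul_mem_lieSeries hev hW)
  · exact evenPart_sub_two_mul_mem_succ hΓ hk hv (hnil v hv) hW
  · exact anticomm_mul_mem_lieSeries_succ hΓ hk hu0 hv0 hW
  · exact mul_mem_lieSeries heu (lie_mem_lieSeries hv0 hW)
  · exact mul_mem_lieSeries hev (lie_mem_lieSeries hu0 hW)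

theorem lieSeries_le_closure_sup (hΓ : ∀ u ∈ Γ, evenPart u ∈ Subring.center Q)
    (hk : (2 * k : Q) = 1) (hnil : ∀ u ∈ Γ, IsNilpotent (evenPart u - 2)) (n : ℕ) :
    lieSeries Γ n ≤
      AddSubgroup.closure (oddPart '' (Γ : Set Qˣ) ∩ lieSeries Γ n) ⊔ lieSeries Γ (n + 1) := by
  induction n with
  | zero =>
    refine le_trans ((AddSubgroup.closure_le _).2 ?_) le_sup_left
    rintro _ ⟨u, hu, rfl⟩
    exact AddSubgroup.subset_closure ⟨⟨u, hu, rfl⟩, oddPart_mem_lieSeries_zero hu⟩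
  | succ n ih =>
    refine lieSeries_succ_le_iff.2 fun x hx y hy => ?_
    set N := AddSubgroup.closure (oddPart '' (Γ : Set Qˣ) ∩ lieSeries Γ (n + 1)) ⊔
      lieSeries Γ (n + 1 + 1)
    obtain ⟨y₁, hy₁, y₂, hy₂, rfl⟩ := AddSubgroup.mem_sup.1 (ih hy)
    have hlie_add : ⁅x, y₁ + y₂⁆ = ⁅x, y₁⁆ + ⁅x, y₂⁆ := by
      simp only [Ring.lie_def]
      noncomm_ring
    rw [hlie_add]
    refine add_mem (lie_mem_of_mem_closure ?_ hx hy₁)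
      (AddSubgroup.mem_sup_right (lie_mem_lieSeries hx hy₂))
    rintro _ ⟨u, hu, rfl⟩ _ ⟨⟨v, hv, rfl⟩, hvn⟩
    have hcomm := two_mul_oddPart_commutator_sub_mem hΓ hk hnil hu hv hvn
    have hW : ⁅oddPart u, oddPart v⁆ ∈ lieSeries Γ (n + 1) :=
      lie_mem_lieSeries (oddPart_mem_lieSeries_zero hu) hvn
    set w := u * v * u⁻¹ * v⁻¹
    have hwΓ : w ∈ Γ := mul_mem (mul_mem (mul_mem hu hv) (inv_mem hu)) (inv_mem hv)
    have hwn : oddPart w ∈ lieSeries Γ (n + 1) := mem_of_two_mul_mem hk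
      (by simpa only [sub_add_cancel] using add_mem (lieSeries_succ_le _ hcomm) hW)
    have hwN : oddPart w ∈ N :=
      AddSubgroup.mem_sup_left (AddSubgroup.subset_closure ⟨⟨w, hwΓ, rfl⟩, hwn⟩)
    have hsub : 2 * oddPart w - (2 * oddPart w - ⁅oddPart u, oddPart v⁆) ∈ N :=
      sub_mem (two_mul (oddPart w) ▸ add_mem hwN hwN) (AddSubgroup.mem_sup_right hcomm)
    rwa [sub_sub_cancel] at hsub

theorem exists_oddPart_add_sub_mem_succ (hΓ : ∀ u ∈ Γ, evenPart u ∈ Subring.center Q)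
    (hk : (2 * k : Q) = 1) (hnil : ∀ u ∈ Γ, IsNilpotent (evenPart u - 2)) {n : ℕ} {z : Q}
    (hz : z ∈ lieSeries Γ (n + 1)) {u : Qˣ} (hu : u ∈ Γ) :
    ∃ v ∈ Γ, oddPart u + z - oddPart v ∈ lieSeries Γ (n + 2) := by
  obtain ⟨y, hy, e, he, rfl⟩ :=
    AddSubgroup.mem_sup.1 (lieSeries_le_closure_sup hΓ hk hnil (n + 1) hz)
  suffices h : ∀ u ∈ Γ, ∃ v ∈ Γ, oddPart u + y - oddPart v ∈ lieSeries Γ (n + 2) by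
    obtain ⟨v, hv, hmem⟩ := h u hu
    refine ⟨v, hv, ?_⟩
    rw [← add_assoc, add_sub_right_comm]
    exact add_mem hmem he
  clear hz hu
  have hmul {u w : Qˣ} (hu : u ∈ Γ) (hw : w ∈ Γ) (hwn : oddPart w ∈ lieSeries Γ (n + 1)) :=
    oddPart_add_sub_oddPart_mul_mem hΓ hk hnil hu hw hwn
  induction hy using AddSubgroup.closure_induction'' with
  | mem y hy =>
    obtain ⟨⟨w, hw, rfl⟩, hwn⟩ := hy
    exact fun u hu => ⟨u * w, mul_mem hu hw, hmul hu hw hwn⟩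
  | neg_mem y hy =>
    obtain ⟨⟨w, hw, rfl⟩, hwn⟩ := hy
    refine fun u hu => ⟨u * w⁻¹, mul_mem hu (inv_mem hw), ?_⟩
    rw [← oddPart_inv]
    exact hmul hu (inv_mem hw) (oddPart_inv w ▸ neg_mem hwn)
  | zero => exact fun u hu => ⟨u, hu, by simp only [add_zero, sub_self, zero_mem]⟩
  | add x y _ _ hx hy =>
    intro u hu
    obtain ⟨v, hv, hvx⟩ := hx u hu
    obtain ⟨w, hw, hwy⟩ := hy v hv
    refine ⟨w, hw, ?_⟩
    convert add_mem hvx hwy using 1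
    abel

theorem exists_oddPart_add_sub_mem (hΓ : ∀ u ∈ Γ, evenPart u ∈ Subring.center Q)
    (hk : (2 * k : Q) = 1) (hnil : ∀ u ∈ Γ, IsNilpotent (evenPart u - 2)) {z : Q}
    (hz : z ∈ lieSeries Γ 1) {u : Qˣ} (hu : u ∈ Γ) (n : ℕ) :
    ∃ v ∈ Γ, oddPart u + z - oddPart v ∈ lieSeries Γ (n + 1) := by
  induction n with
  | zero => exact ⟨u, hu, by rwa [add_sub_cancel_left]⟩
  | succ n ih =>
    obtain ⟨v, hv, hv'⟩ := ih
    obtain ⟨w, hw, hw'⟩ := exists_oddPart_add_sub_mem_succ hΓ hk hnil hv' hv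
    exact ⟨w, hw, by rwa [add_sub_cancel] at hw'⟩

end LieSeries

section NilpotentIdeal

variable {Q : Type*} [Ring Q] {Γ : Subgroup Qˣ} {J : Ideal Q} {k : ℕ}

theorem evenPart_sub_two_mem {u : Qˣ} (hu : (u : Q) - 1 ∈ J) : evenPart u - 2 ∈ J := by
  have hfactor : evenPart u - 2 = (1 - ↑u⁻¹) * ((u : Q) - 1) := by
    rw [sub_mul, mul_sub (↑u⁻¹ : Q), u.inv_mul, evenPart, ← one_add_one_eq_two, mul_one, one_mul]
    abel
  exact hfactor ▸ J.mul_mem_left _ hu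

theorem oddPart_mem_ideal {u : Qˣ} (hu : (u : Q) - 1 ∈ J) : oddPart u ∈ J := by
  have hfactor : oddPart u = (1 + ↑u⁻¹) * ((u : Q) - 1) := by
    rw [add_mul, mul_sub (↑u⁻¹ : Q), u.inv_mul, oddPart, mul_one, one_mul, sub_add_sub_cancel]
  exact hfactor ▸ J.mul_mem_left _ hu

theorem isNilpotent_of_mem_of_isNilpotent (hJ : IsNilpotent J) {x : Q} (hx : x ∈ J) :
    IsNilpotent x := by
  obtain ⟨N, hN⟩ := hJ
  have hpow := Ideal.pow_mem_pow hx N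
  rw [hN] at hpow
  exact ⟨N, hpow⟩

theorem lieSeries_le_pow (hΓJ : ∀ u ∈ Γ, (u : Q) - 1 ∈ J) (n : ℕ) :
    lieSeries Γ n ≤ (J ^ (n + 1)).toAddSubgroup := by
  have hzero : lieSeries Γ 0 ≤ J.toAddSubgroup := by
    refine (AddSubgroup.closure_le _).2 ?_
    rintro _ ⟨u, hu, rfl⟩
    exact oddPart_mem_ideal (hΓJ u hu)
  induction n with
  | zero => simpa only [zero_add, Submodule.pow_one] using hzero
  | succ n ih =>
    refine lieSeries_succ_le_iff.2 fun x hx y hy => sub_mem ?_ ?_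
    · rw [Submodule.pow_succ' _ n.succ_ne_zero]
      exact Ideal.mul_mem_mul (hzero hx) (ih hy)
    · rw [Submodule.pow_succ]
      exact Ideal.mul_mem_mul (ih hy) (hzero hx)

theorem exists_oddPart_eq_add (hΓ : ∀ u ∈ Γ, evenPart u ∈ Subring.center Q)
    (hk : (2 * k : Q) = 1) (hJ : IsNilpotent J) (hΓJ : ∀ u ∈ Γ, (u : Q) - 1 ∈ J) {z : Q}
    (hz : z ∈ lieSeries Γ 1) {u : Qˣ} (hu : u ∈ Γ) : ∃ v ∈ Γ, oddPart v = oddPart u + z := by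
  obtain ⟨N, hN⟩ := id hJ
  have hnil (u : Qˣ) (hu : u ∈ Γ) : IsNilpotent (evenPart u - 2) :=
    isNilpotent_of_mem_of_isNilpotent hJ (evenPart_sub_two_mem (hΓJ u hu))
  obtain ⟨v, hv, hmem⟩ := exists_oddPart_add_sub_mem hΓ hk hnil hz hu N
  have hpow := lieSeries_le_pow hΓJ _ hmem
  rw [Submodule.mem_toAddSubgroup, Submodule.pow_succ, Submodule.pow_succ, hN, zero_mul, zero_mul,
    Submodule.zero_eq_bot, Submodule.mem_bot] at hpow
  exact ⟨v, hv, (sub_eq_zero.1 hpow).symm⟩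

theorem oddPart_injOn (hΓ : ∀ u ∈ Γ, evenPart u ∈ Subring.center Q) (h2 : IsUnit (2 : Q))
    (hJ : IsNilpotent J) (hΓJ : ∀ u ∈ Γ, (u : Q) - 1 ∈ J) :
    Set.InjOn oddPart (Γ : Set Qˣ) := by
  intro u hu v hv huv
  have hsum : IsUnit (evenPart u + evenPart v) := by
    have hnil := isNilpotent_of_mem_of_isNilpotent hJ
      (add_mem (evenPart_sub_two_mem (hΓJ u hu)) (evenPart_sub_two_mem (hΓJ v hv)))
    have hcomm : Commute (evenPart u - 2 + (evenPart v - 2)) (2 * 2) :=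
      ((Subring.mem_center_iff.1 (add_mem (sub_mem (hΓ u hu) (ofNat_mem _ 2))
        (sub_mem (hΓ v hv) (ofNat_mem _ 2))) (2 * 2)).symm)
    convert hnil.isUnit_add_left_of_commute (h2.mul h2) hcomm using 1
    noncomm_ring
  have hprod : (evenPart u + evenPart v) * (evenPart u - evenPart v) = 0 := by
    rw [add_mul, mul_sub, mul_sub, Subring.mem_center_iff.1 (hΓ u hu) (evenPart v),
      sub_add_sub_cancel, evenPart_mul_self, evenPart_mul_self, huv, sub_self]
  have heven : evenPart u = evenPart v := sub_eq_zero.1 (hsum.mul_right_eq_zero.1 hprod)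
  refine Units.ext (h2.mul_left_cancel ?_)
  rw [← evenPart_add_oddPart, ← evenPart_add_oddPart, heven, huv]

theorem mul_ncard_le_ncard_of_oddPart_sub_ne [Finite Γ]
    (hΓ : ∀ u ∈ Γ, evenPart u ∈ Subring.center Q) (hk : (2 * k : Q) = 1) (hJ : IsNilpotent J)
    (hΓJ : ∀ u ∈ Γ, (u : Q) - 1 ∈ J) {z : Q} (hz : z ∈ lieSeries Γ 1) {T : Set Qˣ}
    (hTΓ : T ⊆ Γ) {p : ℕ}
    (hT : ∀ u ∈ T, ∀ v ∈ T, ∀ i, 0 < i → i < p → oddPart u - oddPart v ≠ i • z) :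
    p * T.ncard ≤ (Γ : Set Qˣ).ncard := by
  have h2 : IsUnit (2 : Q) :=
    isUnit_iff_exists.2 ⟨k, hk, by rw [(Nat.cast_commute k (2 : Q)).eq, hk]⟩
  let translate : ℕ × Qˣ → Q := fun x => oddPart x.2 + x.1 • z
  have hmaps : Set.MapsTo translate (Set.Iio p ×ˢ T) (oddPart '' (Γ : Set Qˣ)) := fun x hx =>
    exists_oddPart_eq_add hΓ hk hJ hΓJ (nsmul_mem hz x.1) (hTΓ hx.2)
  have hle {x y : ℕ × Qˣ} (hx : x ∈ Set.Iio p ×ˢ T) (hy : y ∈ Set.Iio p ×ˢ T)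
      (hxy : translate x = translate y) : y.1 ≤ x.1 := by
    by_contra! hlt
    refine hT x.2 hx.2 y.2 hy.2 (y.1 - x.1) (Nat.sub_pos_of_lt hlt)
      ((Nat.sub_le _ _).trans_lt hy.1) ?_
    rw [sub_nsmul z hlt.le, ← sub_eq_add_neg, sub_eq_sub_iff_add_eq_add, add_comm (y.1 • z)]
    exact hxy
  have hinj : Set.InjOn translate (Set.Iio p ×ˢ T) := by
    intro x hx y hy hxy
    have hfst : x.1 = y.1 := le_antisymm (hle hy hx hxy.symm) (hle hx hy hxy)
    have hadd : oddPart x.2 + x.1 • z = oddPart y.2 + y.1 • z := hxy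
    rw [hfst] at hadd
    exact Prod.ext hfst (oddPart_injOn hΓ h2 hJ hΓJ (hTΓ hx.2) (hTΓ hy.2) (add_right_cancel hadd))
  have hfin : (Γ : Set Qˣ).Finite := Set.toFinite _
  calc p * T.ncard = (Set.Iio p ×ˢ T).ncard := by rw [Set.ncard_prod, Set.ncard_Iio_nat]
    _ ≤ (oddPart '' (Γ : Set Qˣ)).ncard :=
        Set.ncard_le_ncard_of_injOn translate hmaps hinj (hfin.image _)
    _ ≤ (Γ : Set Qˣ).ncard := Set.ncard_image_le hfin

end NilpotentIdeal

/-! ### Fibres of homomorphisms with open kernel -/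

section OpenKernel

variable {G H : Type*} [Group G] [Group H] [TopologicalSpace G] [IsTopologicalGroup G]
  [CompactSpace G] {φ : G →* H}

theorem finite_range_of_isOpen_ker (hφ : IsOpen (φ.ker : Set G)) : Finite φ.range :=
  have _ := Subgroup.quotient_finite_of_isOpen _ hφ
  Finite.of_equiv _ (QuotientGroup.quotientKerEquivRange φ).toEquiv

variable [MeasurableSpace G] [BorelSpace G] {μ : Measure G} [μ.IsMulLeftInvariant]

theorem measure_preimage_eq_ncard_mul_measure_ker (hφ : IsOpen (φ.ker : Set G)) {T : Set H}
    (hT : T ⊆ φ.range) : μ (φ ⁻¹' T) = T.ncard * μ (φ.ker : Set G) := by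
  have hfin : T.Finite := Set.Finite.subset (finite_range_of_isOpen_ker hφ) hT
  have hfiber (g : G) : φ ⁻¹' {φ g} = (fun x => g⁻¹ * x) ⁻¹' (φ.ker : Set G) := by
    ext x
    simp only [Set.mem_preimage, Set.mem_singleton_iff, SetLike.mem_coe, MonoidHom.mem_ker,
      map_mul, map_inv, inv_mul_eq_one]
    exact eq_comm
  have hmeas : ∀ u ∈ T, MeasurableSet (φ ⁻¹' {u}) := fun u hu => by
    obtain ⟨g, rfl⟩ := hT hu
    exact hfiber g ▸ (hφ.preimage (continuous_const_mul g⁻¹)).measurableSet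
  have hconst : ∀ u ∈ T, μ (φ ⁻¹' {u}) = μ (φ.ker : Set G) := fun u hu => by
    obtain ⟨g, rfl⟩ := hT hu
    rw [hfiber, measure_preimage_mul]
  lift T to Finset H using hfin
  rw [← sum_measure_preimage_singleton T hmeas, Finset.sum_congr rfl hconst, Finset.sum_const,
    Set.ncard_coe_finset, nsmul_eq_mul]

theorem natCard_range_mul_measure_ker (hφ : IsOpen (φ.ker : Set G)) :
    Nat.card φ.range * μ (φ.ker : Set G) = μ Set.univ := by
  have h := measure_preimage_eq_ncard_mul_measure_ker (μ := μ) hφ (subset_refl (φ.range : Set H))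
  rw [MonoidHom.coe_range, Set.preimage_range, ← MonoidHom.coe_range, ← Nat.card_coe_set_eq] at h
  exact h.symm

theorem mul_measure_le_of_mul_ncard_image_le (hφ : IsOpen (φ.ker : Set G)) {N : Subgroup G}
    (hN : φ.ker ≤ N) {M : Set G} {c : ℕ}
    (h : c * (φ '' M).ncard ≤ (N.map φ : Set H).ncard) : c * μ M ≤ μ N := by
  calc c * μ M ≤ c * μ (φ ⁻¹' (φ '' M)) := by gcongr; exact Set.subset_preimage_image φ M
    _ = (c * (φ '' M).ncard : ℕ) * μ (φ.ker : Set G) := by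
        rw [measure_preimage_eq_ncard_mul_measure_ker hφ (Set.image_subset_range φ M),
          Nat.cast_mul, mul_assoc]
    _ ≤ (N.map φ : Set H).ncard * μ (φ.ker : Set G) := by gcongr
    _ = μ N := by
        rw [← measure_preimage_eq_ncard_mul_measure_ker hφ (N.map_le_range φ), ← Subgroup.coe_comap,
          Subgroup.comap_map_eq_self hN]

end OpenKernel

section CompactExhaustion

variable {X : Type*} [TopologicalSpace X] [MeasurableSpace X] {μ : Measure X}
  [IsFiniteMeasure μ] [μ.InnerRegularCompactLTTop]

theorem measureReal_le_div_add_of_forall_isCompact {N S : Set X} (hN : MeasurableSet N) {c : ℕ}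
    (hc : c ≠ 0) (h : ∀ M ⊆ N \ S, IsCompact M → c * μ M ≤ μ N) :
    μ.real N ≤ μ.real N / c + μ.real S := by
  let S' := toMeasurable μ S
  have hdiff : μ (N \ S') ≤ μ N / c := by
    rw [(hN.diff (measurableSet_toMeasurable μ S)).measure_eq_iSup_isCompact_of_ne_top
      (measure_ne_top μ _)]
    refine iSup_le fun M => iSup_le fun hM => iSup_le fun hMc => ?_
    rw [ENNReal.le_div_iff_mul_le (Or.inl (Nat.cast_ne_zero.2 hc))
      (Or.inl (ENNReal.natCast_ne_top c)), mul_comm]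
    exact h M (hM.trans (Set.sdiff_subset_sdiff_right (subset_toMeasurable μ S))) hMc
  calc μ.real N ≤ μ.real (N \ S') + μ.real S' :=
        (measureReal_mono (Set.subset_sdiff_union N S')).trans (measureReal_union_le _ _)
    _ ≤ μ.real N / c + μ.real S := by
        refine add_le_add ?_ (congrArg ENNReal.toReal (measure_toMeasurable S)).le
        have hfin := ENNReal.div_ne_top (measure_ne_top μ N) (Nat.cast_ne_zero.2 hc)
        simpa only [Measure.real, ENNReal.toReal_div, ENNReal.toReal_natCast] using
          ENNReal.toReal_mono hfin hdiff

end CompactExhaustion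

/-! ### Generalized matrix algebras -/

namespace GMA

section Basic

variable {A B C : Type*} [CommRing A] [AddCommGroup B] [Module A B] [AddCommGroup C] [Module A C]
  {R : GMA A B C}

theorem tr_add (x y : R.Alg) : tr (x + y) = tr x + tr y := by
  simp only [tr, e₁₁_add, e₂₂_add]
  ring

theorem tr_smul (a : A) (x : R.Alg) : tr (a • x) = a * tr x := by
  simp only [tr, e₁₁_smul, e₂₂_smul]
  ring

/-- The trace of a generalized matrix algebra as a linear map. -/
def trₗ (R : GMA A B C) : R.Alg →ₗ[A] A where
  toFun := tr
  map_add' := tr_add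
  map_smul' := tr_smul

theorem tr_sub (x y : R.Alg) : tr (x - y) = tr x - tr y := map_sub (trₗ R) x y

theorem tr_zero : tr (0 : R.Alg) = 0 := map_zero (trₗ R)

theorem tr_nsmul (n : ℕ) (x : R.Alg) : tr (n • x) = n • tr x := map_nsmul (trₗ R) n x

theorem tr_mul_comm (x y : R.Alg) : tr (x * y) = tr (y * x) := by
  simp only [tr, e₁₁_mul, e₂₂_mul]
  ring

theorem m_mul_m_comm (b b' : B) (c c' : C) : R.m b c * R.m b' c' = R.m b' c * R.m b c' := by
  simpa only [map_smul, LinearMap.smul_apply, smul_eq_mul]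
    using congrArg (fun z => R.m z c') (R.assoc_left b b' c)

theorem det_mul (x y : R.Alg) : det (x * y) = det x * det y := by
  simp only [det, e₁₁_mul, e₁₂_mul, e₂₁_mul, e₂₂_mul, map_add, map_smul, LinearMap.add_apply,
    LinearMap.smul_apply, smul_eq_mul]
  linear_combination -m_mul_m_comm (R := R) (e₁₂ x) (e₁₂ y) (e₂₁ x) (e₂₁ y)

theorem det_one : det (1 : R.Alg) = 1 := by
  simp only [det, e₁₁_one, e₂₂_one, e₁₂_one, map_zero, LinearMap.zero_apply, mul_one, sub_zero]

theorem det_one_add (x : R.Alg) : det (1 + x) = 1 + (tr x + det x) := by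
  simp only [det, tr, e₁₁_add, e₂₂_add, e₁₂_add, e₂₁_add, e₁₁_one, e₂₂_one, e₁₂_one, e₂₁_one,
    zero_add]
  ring

theorem two_mul_det (x : R.Alg) : 2 * det x = tr x * tr x - tr (x * x) := by
  simp only [tr, det, e₁₁_mul, e₂₂_mul]
  ring

theorem mul_self_add_det_smul_one (x : R.Alg) : x * x + det x • (1 : R.Alg) = tr x • x := by
  apply alg_ext
  · simp only [e₁₁_add, e₁₁_mul, e₁₁_smul, e₁₁_one, tr, det]
    ring
  · simp only [e₁₂_add, e₁₂_mul, e₁₂_smul, e₁₂_one, tr, smul_zero, add_zero, add_smul]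
  · simp only [e₂₁_add, e₂₁_mul, e₂₁_smul, e₂₁_one, tr, smul_zero, add_zero, add_smul]
  · simp only [e₂₂_add, e₂₂_mul, e₂₂_smul, e₂₂_one, tr, det]
    ring

theorem mul_tr_smul_one_sub (x : R.Alg) : x * (tr x • 1 - x) = det x • 1 := by
  rw [mul_sub, mul_smul_comm, mul_one, ← mul_self_add_det_smul_one, add_sub_cancel_left]

theorem tr_smul_one_sub_mul (x : R.Alg) : (tr x • 1 - x) * x = det x • 1 := by
  rw [sub_mul, smul_mul_assoc, one_mul, ← mul_self_add_det_smul_one, add_sub_cancel_left]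

theorem isUnit_of_isUnit_det {x : R.Alg} (h : IsUnit (det x)) : IsUnit x := by
  obtain ⟨a, ha⟩ := h.exists_right_inv
  refine isUnit_iff_exists.2 ⟨a • (tr x • 1 - x), ?_, ?_⟩
  · rw [mul_smul_comm, mul_tr_smul_one_sub, smul_smul, mul_comm, ha, one_smul]
  · rw [smul_mul_assoc, tr_smul_one_sub_mul, smul_smul, mul_comm, ha, one_smul]

theorem coe_inv_eq_of_det_eq_one {u : R.Algˣ} (h : det (u : R.Alg) = 1) :
    ((u⁻¹ : R.Algˣ) : R.Alg) = tr (u : R.Alg) • 1 - (u : R.Alg) :=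
  Units.inv_eq_of_mul_eq_one_right (by rw [mul_tr_smul_one_sub, h, one_smul])

end Basic

section Jacobson

variable {A B C : Type*} [CommRing A] [AddCommGroup B] [Module A B] [AddCommGroup C] [Module A C]
  {R : GMA A B C}

theorem isUnit_det_one_add_mul {y : R.Alg} (hy : y ∈ Ring.jacobson R.Alg) (x : R.Alg) :
    IsUnit (det (1 + x * y)) := by
  rw [← Ideal.jacobson_bot, Ideal.mem_jacobson_iff] at hy
  obtain ⟨z, hz⟩ := hy x
  have hinv : z * (1 + x * y) = 1 := by
    rw [Ideal.mem_bot, sub_eq_zero] at hz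
    rw [mul_add, mul_one, add_comm, ← mul_assoc, hz]
  exact IsUnit.of_mul_eq_one_right (det z) (by rw [← det_mul, hinv, det_one])

theorem e₁₁_mem_jacobson {y : R.Alg} (hy : y ∈ Ring.jacobson R.Alg) :
    e₁₁ y ∈ Ring.jacobson A := by
  rw [← Ideal.jacobson_bot, Ideal.mem_jacobson_bot]
  intro c
  convert isUnit_det_one_add_mul hy (ofEntries c 0 0 0) using 1
  rw [det_one_add, tr, det, e₁₁_mul, e₂₂_mul, e₂₁_mul]
  simp [ofEntries, e₁₁, e₁₂, e₂₁, e₂₂, add_comm, mul_comm]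

theorem e₂₂_mem_jacobson {y : R.Alg} (hy : y ∈ Ring.jacobson R.Alg) :
    e₂₂ y ∈ Ring.jacobson A := by
  rw [← Ideal.jacobson_bot, Ideal.mem_jacobson_bot]
  intro c
  convert isUnit_det_one_add_mul hy (ofEntries 0 0 0 c) using 1
  rw [det_one_add, tr, det, e₁₁_mul, e₂₂_mul, e₁₂_mul]
  simp [ofEntries, e₁₁, e₁₂, e₂₁, e₂₂, add_comm, mul_comm]

theorem det_mem_jacobson {y : R.Alg} (hy : y ∈ Ring.jacobson R.Alg) : det y ∈ Ring.jacobson A := by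
  have h := e₁₁_mem_jacobson (tr_smul_one_sub_mul y ▸ Ideal.mul_mem_left _ (tr y • 1 - y) hy)
  rwa [e₁₁_smul, e₁₁_one, mul_one] at h

theorem det_sub_one_mem_jacobson {x : R.Alg} (hx : x - 1 ∈ Ring.jacobson R.Alg) :
    det x - 1 ∈ Ring.jacobson A := by
  have h := det_one_add (x - 1)
  rw [add_sub_cancel] at h
  rw [h, add_sub_cancel_left]
  exact add_mem (add_mem (e₁₁_mem_jacobson hx) (e₂₂_mem_jacobson hx)) (det_mem_jacobson hx)

theorem det_eq_one_of_sub_one_mem_jacobson {F : Type*} [Field F] [Algebra F A] {x : R.Alg}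
    (hx : x - 1 ∈ Ring.jacobson R.Alg) (hdet : det x ∈ Set.range (algebraMap F A)) :
    det x = 1 := by
  obtain ⟨c, hc⟩ := hdet
  have hmem := det_sub_one_mem_jacobson hx
  rw [← Ideal.jacobson_bot, Ideal.mem_jacobson_bot] at hmem
  by_cases hc1 : c = 1
  · rw [← hc, hc1, map_one]
  have h := hmem (-algebraMap F A (c - 1)⁻¹)
  rw [← hc, ← map_one (algebraMap F A), ← map_sub, mul_neg, ← map_mul,
    mul_inv_cancel₀ (sub_ne_zero.2 hc1), neg_add_cancel, isUnit_zero_iff] at h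
  exact eq_of_zero_eq_one h _ _

/-- The two-sided ideal of the `y` such that `tr (x * y) ∈ I` for all `x`. For faithful `R` these
ideals are the neighbourhoods of zero through which `R` is approximated by finite rings. -/
def traceIdeal (R : GMA A B C) (I : Ideal A) : Ideal R.Alg where
  carrier := {y | ∀ x : R.Alg, tr (x * y) ∈ I}
  zero_mem' x := by rw [mul_zero, tr_zero]; exact I.zero_mem
  add_mem' hy hz x := by rw [mul_add, tr_add]; exact I.add_mem (hy x) (hz x)
  smul_mem' c y hy x := by rw [smul_eq_mul, ← mul_assoc]; exact hy _

instance traceIdeal_isTwoSided (I : Ideal A) : (R.traceIdeal I).IsTwoSided where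
  mul_mem_of_left {y} z hy x := by
    rw [← mul_assoc, tr_mul_comm, ← mul_assoc]
    exact hy _

theorem traceIdeal_mono {I I' : Ideal A} (h : I ≤ I') : R.traceIdeal I ≤ R.traceIdeal I' :=
  fun _ hy x => h (hy x)

theorem smul_mem_traceIdeal {I : Ideal A} {a : A} (ha : a ∈ I) (y : R.Alg) :
    a • y ∈ R.traceIdeal I := fun x => by
  rw [mul_smul_comm, tr_smul]
  exact I.mul_mem_right _ ha

theorem mem_traceIdeal_of_span_eq_top {X : Set R.Alg} (hX : Submodule.span A X = ⊤) {I : Ideal A}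
    {y : R.Alg} (h : ∀ x ∈ X, tr (x * y) ∈ I) : y ∈ R.traceIdeal I := fun x =>
  (Submodule.span_le (p := Submodule.comap ((trₗ R).comp (LinearMap.mulRight A y)) I)).2 h
    (hX ▸ Submodule.mem_top : x ∈ Submodule.span A X)

theorem det_mem_of_mem_traceIdeal (h2 : IsUnit (2 : A)) {I : Ideal A} {y : R.Alg}
    (hy : y ∈ R.traceIdeal I) : det y ∈ I := by
  have htr : tr y ∈ I := one_mul y ▸ hy 1
  rw [← I.unit_mul_mem_iff_mem h2, two_mul_det]
  exact sub_mem (I.mul_mem_left _ htr) (hy y)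

theorem traceIdeal_jacobson_le (h2 : IsUnit (2 : A)) :
    R.traceIdeal (Ring.jacobson A) ≤ Ring.jacobson R.Alg := by
  intro y hy
  rw [← Ideal.jacobson_bot, Ideal.mem_jacobson_iff]
  intro x
  have hxy : x * y ∈ R.traceIdeal (Ring.jacobson A) := Ideal.mul_mem_left _ x hy
  have hmem : tr (x * y) + det (x * y) ∈ Ring.jacobson A :=
    add_mem (hy x) (det_mem_of_mem_traceIdeal h2 hxy)
  have hunit : IsUnit (1 + x * y) := by
    rw [← Ideal.jacobson_bot, Ideal.mem_jacobson_bot] at hmem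
    refine isUnit_of_isUnit_det ?_
    simpa only [det_one_add, mul_one, add_comm (1 : A)] using hmem 1
  obtain ⟨z, hz⟩ := hunit.exists_left_inv
  refine ⟨z, ?_⟩
  rw [Ideal.mem_bot, ← hz]
  noncomm_ring

theorem eq_zero_of_forall_mem_traceIdeal (h2 : IsUnit (2 : A)) (hR : R.IsFaithful)
    {y : R.Alg} {s : Set (Ideal A)} (hs : sInf s = ⊥) (hy : ∀ I ∈ s, y ∈ R.traceIdeal I) :
    y = 0 := by
  have hmem : y ∈ R.traceIdeal ⊥ := fun x => hs ▸ Ideal.mem_sInf.2 fun {I} hI => hy I hI x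
  exact hR y (det_mem_of_mem_traceIdeal h2 hmem) fun x => tr_mul_comm y x ▸ hmem x

end Jacobson

end GMA

section FiniteQuotients

variable {A M : Type*} [CommRing A] [AddCommGroup M] [Module A M] {I : Ideal A}

theorem isOpen_of_forall_smul_mem [TopologicalSpace A] [IsTopologicalRing A] [TopologicalSpace M]
    [IsModuleTopology A M] (hI : IsOpen (I : Set A)) {N : Submodule A M}
    (hN : ∀ a ∈ I, ∀ x, a • x ∈ N) : IsOpen (N : Set M) := by
  let _ : TopologicalSpace (M ⧸ N) := ⊥
  have _ : DiscreteTopology (M ⧸ N) := ⟨rfl⟩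
  have _ : ContinuousSMul A (M ⧸ N) := by
    refine ⟨continuous_prod_of_discrete_right.2 fun q => ?_⟩
    refine continuous_of_continuousAt_zero (LinearMap.toSpanSingleton A (M ⧸ N) q) ?_
    refine (continuousAt_const (y := (0 : M ⧸ N))).congr ?_
    filter_upwards [hI.mem_nhds I.zero_mem] with a ha
    obtain ⟨x, rfl⟩ := N.mkQ_surjective q
    exact ((Submodule.Quotient.mk_eq_zero N).2 (hN a ha x)).symm
  have hcont : Continuous N.mkQ := IsModuleTopology.continuous_of_linearMap N.mkQ
  have hpre : (N : Set M) = N.mkQ ⁻¹' {0} := by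
    ext x
    exact (Submodule.Quotient.mk_eq_zero N).symm
  exact hpre ▸ (isOpen_discrete _).preimage hcont

theorem finite_of_isTorsionBySet [Module.Finite A M] [Finite (A ⧸ I)]
    (h : Module.IsTorsionBySet A M I) : Finite M := by
  let _ : Module (A ⧸ I) M := h.module
  have _ : IsScalarTower A (A ⧸ I) M := h.isScalarTower
  have _ : Module.Finite (A ⧸ I) M := Module.Finite.of_restrictScalars_finite A (A ⧸ I) M
  exact Module.finite_of_finite (A ⧸ I)

end FiniteQuotients

namespace GMA

section ModuleTopology

variable {A B C : Type*} [CommRing A] [AddCommGroup B] [Module A B] [AddCommGroup C]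
  [Module A C] {R : GMA A B C} [TopologicalSpace A] [IsTopologicalRing A] {I : Ideal A}

theorem isOpen_traceIdeal (hI : IsOpen (I : Set A)) : IsOpen (R.traceIdeal I : Set R.Alg) :=
  have _ : IsModuleTopology A R.Alg := ⟨rfl⟩
  isOpen_of_forall_smul_mem (N := (R.traceIdeal I).restrictScalars A) hI
    fun _ ha y => smul_mem_traceIdeal ha y

theorem mk_mem_closure_of_mem_closedAddSpan (hI : IsOpen (I : Set A)) {X : Set R.Alg} {x : R.Alg}
    (hx : x ∈ closedAddSpan X) :
    Ideal.Quotient.mk (R.traceIdeal I) x ∈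
      AddSubgroup.closure (Ideal.Quotient.mk (R.traceIdeal I) '' X) := by
  have _ : IsModuleTopology A R.Alg := ⟨rfl⟩
  have _ : IsTopologicalAddGroup R.Alg := IsModuleTopology.topologicalAddGroup A R.Alg
  have hcont : Continuous fun y : R.Alg => y - x := by fun_prop
  obtain ⟨y, hy, hyX⟩ := mem_closure_iff_nhds.1 hx _
    (((isOpen_traceIdeal hI).preimage hcont).mem_nhds (by simp [zero_mem]))
  rw [← Ideal.Quotient.eq.2 hy]
  have hmap := AddSubgroup.mem_map_of_mem (Ideal.Quotient.mk (R.traceIdeal I)).toAddMonoidHom hyX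
  rwa [AddMonoidHom.map_closure] at hmap

end ModuleTopology

section Reduction

variable {PG A B C : Type*} [Group PG] [CommRing A] [AddCommGroup B] [Module A B] [AddCommGroup C]
  [Module A C] {R : GMA A B C}

/-- The reduction of `ρ` modulo a two-sided ideal of `R`. -/
def reduction (ρ : PG →* R.Algˣ) (J : Ideal R.Alg) [J.IsTwoSided] : PG →* (R.Alg ⧸ J)ˣ :=
  (Units.map (Ideal.Quotient.mk J).toMonoidHom).comp ρ

variable {ρ : PG →* R.Algˣ}

theorem residualImage_eq_range : residualImage ρ = (reduction ρ (Ring.jacobson R.Alg)).range := by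
  rw [residualImage, reduction, MonoidHom.range_eq_map, MonoidHom.range_eq_map, Subgroup.map_map]

theorem mem_ker_reduction {J : Ideal R.Alg} [J.IsTwoSided] {g : PG} :
    g ∈ (reduction ρ J).ker ↔ (ρ g : R.Alg) - 1 ∈ J := by
  rw [MonoidHom.mem_ker, Units.ext_iff, ← Ideal.Quotient.eq]
  rfl

theorem ker_reduction_mono {J J' : Ideal R.Alg} [J.IsTwoSided] [J'.IsTwoSided] (h : J ≤ J') :
    (reduction ρ J).ker ≤ (reduction ρ J').ker := fun _ hg =>
  mem_ker_reduction.2 (h (mem_ker_reduction.1 hg))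

variable [TopologicalSpace PG] [IsTopologicalGroup PG] [CompactSpace PG] [TopologicalSpace A]
  [IsTopologicalRing A] {t : PG → A} {d : PG →* Aˣ} {I : Ideal A}

theorem isOpen_ker_reduction (ht : Continuous t) (hρ : IsTDRep t d R ρ)
    (hI : IsOpen (I : Set A)) : IsOpen ((reduction ρ (R.traceIdeal I)).ker : Set PG) := by
  refine Subgroup.isOpen_of_mem_nhds (g := 1) _ ?_
  have huniform := isCompact_univ.eventually_forall_of_forall_eventually (x₀ := (1 : PG))
    (P := fun g h => t (h * g) - t h ∈ I) (K := (Set.univ : Set PG)) (fun h _ => by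
      have hcont : Continuous fun z : PG × PG => t (z.2 * z.1) - t z.2 := by fun_prop
      exact (hI.preimage hcont).mem_nhds (by simp [zero_mem]))
  filter_upwards [huniform] with g hg
  refine mem_ker_reduction.2 (mem_traceIdeal_of_span_eq_top hρ.span_eq_top ?_)
  rintro _ ⟨h, rfl⟩
  rw [mul_sub, mul_one, tr_sub, ← Units.val_mul, ← map_mul, hρ.tr_eq, hρ.tr_eq]
  exact hg h trivial

theorem finite_quotient_traceIdeal [CompactSpace A] (ht : Continuous t) (hρ : IsTDRep t d R ρ)
    (hI : IsOpen (I : Set A)) : Finite (R.Alg ⧸ R.traceIdeal I) := by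
  have _ : Finite (A ⧸ I) := AddSubgroup.quotient_finite_of_isOpen I.toAddSubgroup hI
  have hrange := finite_range_of_isOpen_ker (isOpen_ker_reduction ht hρ hI)
  let mk : R.Alg →ₗ[A] R.Alg ⧸ R.traceIdeal I := (R.traceIdeal I).mkQ.restrictScalars A
  have hfin : (Set.range fun g => mk (ρ g)).Finite := by
    refine (Set.Finite.image (Units.val) hrange).subset ?_
    rintro _ ⟨g, rfl⟩
    exact ⟨reduction ρ (R.traceIdeal I) g, ⟨g, rfl⟩, rfl⟩
  have hspan : Submodule.span A (Set.range fun g => mk (ρ g)) = ⊤ := by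
    rw [Set.range_comp' mk, Submodule.span_image, hρ.span_eq_top, Submodule.map_top,
      LinearMap.range_eq_top]
    exact (R.traceIdeal I).mkQ_surjective
  have _ : Module.Finite A (R.Alg ⧸ R.traceIdeal I) := ⟨hspan ▸ Submodule.fg_span hfin⟩
  refine finite_of_isTorsionBySet (A := A) (I := I) fun q a => ?_
  obtain ⟨y, rfl⟩ := Ideal.Quotient.mk_surjective q
  exact Ideal.Quotient.eq_zero_iff_mem.2 (smul_mem_traceIdeal a.2 y)

end Reduction

end GMA

section HalfInBaseField

theorem exists_two_mul_natCast_eq_one {p : ℕ} (hp : Odd p) (S : Type*) [NonAssocRing S]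
    [CharP S p] : ∃ k : ℕ, (2 * k : S) = 1 := by
  obtain ⟨m, rfl⟩ := hp
  have hchar := CharP.cast_eq_zero S (2 * m + 1)
  refine ⟨m + 1, ?_⟩
  push_cast at hchar ⊢
  rw [mul_add, ← one_add_one_eq_two, mul_one, ← add_assoc, one_add_one_eq_two, hchar, zero_add]

theorem two_mul_natCast_eq_one_of_ringHom {S S' : Type*} [NonAssocSemiring S]
    [NonAssocSemiring S'] (f : S →+* S') {k : ℕ} (hk : (2 * k : S) = 1) : (2 * k : S') = 1 := by
  simpa only [map_mul, map_ofNat, map_natCast, map_one] using congrArg f hk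

end HalfInBaseField

section PartsMap

variable {S S' : Type*} [Ring S] [Ring S'] (f : S →+* S') (u : Sˣ)

theorem oddPart_map : oddPart (Units.map f.toMonoidHom u) = f (oddPart u) :=
  (map_sub f _ _).symm

theorem evenPart_map : evenPart (Units.map f.toMonoidHom u) = f (evenPart u) :=
  (map_add f _ _).symm

end PartsMap

namespace GMA

section Theta

variable {F A B C : Type*} [Field F] [CommRing A] [Algebra F A] [AddCommGroup B] [Module A B]
  [AddCommGroup C] [Module A C] {R : GMA A B C}

theorem tr_mul_pinkTheta {g : R.Alg} (hg : tr g = 0) (x : R.Alg) :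
    tr (g * pinkTheta F x) = tr (g * x) := by
  rw [pinkTheta, mul_sub, tr_sub, mul_smul_comm, tr_smul, mul_one, hg, mul_zero, sub_zero]

theorem evenPart_eq_tr_smul_one {u : R.Algˣ} (hu : det (u : R.Alg) = 1) :
    evenPart u = tr (u : R.Alg) • (1 : R.Alg) := by
  rw [evenPart, coe_inv_eq_of_det_eq_one hu, add_sub_cancel]

theorem two_mul_pinkTheta (h2 : (2 : F) ≠ 0) {u : R.Algˣ} (hu : det (u : R.Alg) = 1) :
    2 * pinkTheta F (u : R.Alg) = oddPart u := by
  have htr : (2⁻¹ : F) • tr (u : R.Alg) + (2⁻¹ : F) • tr (u : R.Alg) = tr (u : R.Alg) := by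
    rw [← add_smul, ← two_mul, mul_inv_cancel₀ h2, one_smul]
  calc 2 * pinkTheta F (u : R.Alg)
      = u - (((2⁻¹ : F) • tr (u : R.Alg) + (2⁻¹ : F) • tr (u : R.Alg)) • (1 : R.Alg) - u) := by
        rw [pinkTheta, two_mul, add_smul]
        abel
    _ = oddPart u := by rw [htr, oddPart, coe_inv_eq_of_det_eq_one hu]

end Theta

section LieAlgebraModTraceIdeal

variable {PG F A B C : Type*} [Group PG] [Field F] [CommRing A] [Algebra F A] [AddCommGroup B]
  [Module A B] [AddCommGroup C] [Module A C] {R : GMA A B C} {ρ : PG →* R.Algˣ} {I : Ideal A}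

theorem oddPart_reduction (h2 : (2 : F) ≠ 0) {g : PG} (hg : det (ρ g : R.Alg) = 1) :
    oddPart (reduction ρ (R.traceIdeal I) g) =
      Ideal.Quotient.mk (R.traceIdeal I) (2 * pinkTheta F (ρ g : R.Alg)) := by
  rw [two_mul_pinkTheta h2 hg, reduction, MonoidHom.comp_apply, oddPart_map]

theorem evenPart_reduction_mem_center {g : PG} (hg : det (ρ g : R.Alg) = 1) :
    evenPart (reduction ρ (R.traceIdeal I) g) ∈ Subring.center (R.Alg ⧸ R.traceIdeal I) := by
  rw [reduction, MonoidHom.comp_apply, evenPart_map, evenPart_eq_tr_smul_one hg,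
    Subring.mem_center_iff]
  intro q
  obtain ⟨y, rfl⟩ := Ideal.Quotient.mk_surjective q
  rw [← map_mul, ← map_mul, mul_smul_comm, smul_mul_assoc, mul_one, one_mul]

theorem reduction_sub_one_mem_jacobson {g : PG}
    (hg : g ∈ (reduction ρ (Ring.jacobson R.Alg)).ker) :
    (reduction ρ (R.traceIdeal I) g : R.Alg ⧸ R.traceIdeal I) - 1 ∈
      Ring.jacobson (R.Alg ⧸ R.traceIdeal I) := by
  have h := Ring.le_comap_jacobson (Ideal.Quotient.mk (R.traceIdeal I)) (mem_ker_reduction.1 hg)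
  rwa [Ideal.mem_comap, map_sub, map_one] at h

variable [TopologicalSpace A] [IsTopologicalRing A] {k : ℕ}

theorem mk_mem_lieSeries_zero (hk : (2 * k : F) = 1) (hI : IsOpen (I : Set A)) {x : R.Alg}
    (hx : x ∈ pinkLie F ρ) :
    Ideal.Quotient.mk (R.traceIdeal I) x ∈
      lieSeries ((reduction ρ (Ring.jacobson R.Alg)).ker.map (reduction ρ (R.traceIdeal I))) 0 := by
  refine (AddSubgroup.closure_le _).2 ?_ (mk_mem_closure_of_mem_closedAddSpan hI hx)
  rintro _ ⟨_, ⟨_, ⟨⟨g, rfl⟩, hdet, hg⟩, rfl⟩, rfl⟩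
  have hkQ := two_mul_natCast_eq_one_of_ringHom
    (((Ideal.Quotient.mk (R.traceIdeal I)).comp (algebraMap A R.Alg)).comp (algebraMap F A)) hk
  have hodd := oddPart_reduction (I := I) (left_ne_zero_of_mul_eq_one hk) hdet
  rw [map_mul, map_ofNat] at hodd
  exact mem_of_two_mul_mem hkQ
    (hodd ▸ oddPart_mem_lieSeries_zero ⟨g, mem_ker_reduction.2 hg, rfl⟩)

theorem mk_mem_lieSeries_one (hk : (2 * k : F) = 1) (hI : IsOpen (I : Set A)) {x : R.Alg}
    (hx : x ∈ pinkLie₂ F ρ) :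
    Ideal.Quotient.mk (R.traceIdeal I) x ∈
      lieSeries ((reduction ρ (Ring.jacobson R.Alg)).ker.map (reduction ρ (R.traceIdeal I))) 1 := by
  refine (AddSubgroup.closure_le _).2 ?_ (mk_mem_closure_of_mem_closedAddSpan hI hx)
  rintro _ ⟨_, ⟨y, hy, z, hz, rfl⟩, rfl⟩
  rw [map_sub, map_mul, map_mul]
  exact lie_mem_lieSeries (mk_mem_lieSeries_zero hk hI hy) (mk_mem_lieSeries_zero hk hI hz)

theorem mul_ncard_image_reduction_le [Finite (R.Alg ⧸ R.traceIdeal I)] (hk : (2 * k : F) = 1)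
    (hdet : ∀ g ∈ (reduction ρ (Ring.jacobson R.Alg)).ker, det (ρ g : R.Alg) = 1)
    (hI : IsOpen (I : Set A)) {x : R.Alg} (hx : x ∈ pinkLie₂ F ρ) {M : Set PG}
    (hM : M ⊆ (reduction ρ (Ring.jacobson R.Alg)).ker) {p : ℕ}
    (hdisj : ∀ g ∈ M, ∀ h ∈ M, ∀ i, 0 < i → i < p →
      pinkTheta F (ρ g : R.Alg) - pinkTheta F (ρ h : R.Alg) - i • x ∉ R.traceIdeal I) :
    p * (reduction ρ (R.traceIdeal I) '' M).ncard ≤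
      ((reduction ρ (Ring.jacobson R.Alg)).ker.map (reduction ρ (R.traceIdeal I)) :
        Set (R.Alg ⧸ R.traceIdeal I)ˣ).ncard := by
  have hkR := two_mul_natCast_eq_one_of_ringHom
    ((algebraMap A R.Alg).comp (algebraMap F A)) hk
  have hkQ := two_mul_natCast_eq_one_of_ringHom (Ideal.Quotient.mk (R.traceIdeal I)) hkR
  refine mul_ncard_le_ncard_of_oddPart_sub_ne (J := Ring.jacobson _)
    (z := Ideal.Quotient.mk (R.traceIdeal I) (2 * x)) ?_ hkQ IsSemiprimaryRing.isNilpotent ?_ ?_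
    (Set.image_mono hM) ?_
  · rintro _ ⟨g, hg, rfl⟩
    exact evenPart_reduction_mem_center (hdet g hg)
  · rintro _ ⟨g, hg, rfl⟩
    exact reduction_sub_one_mem_jacobson hg
  · rw [two_mul, map_add]
    exact add_mem (mk_mem_lieSeries_one hk hI hx) (mk_mem_lieSeries_one hk hI hx)
  · rintro _ ⟨g, hg, rfl⟩ _ ⟨h, hh, rfl⟩ i hi0 hip heq
    have h2 := left_ne_zero_of_mul_eq_one hk
    rw [oddPart_reduction h2 (hdet g (hM hg)), oddPart_reduction h2 (hdet h (hM hh)), ← map_sub,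
      ← map_nsmul, Ideal.Quotient.eq, ← mul_sub, ← mul_smul_comm, ← mul_sub] at heq
    exact hdisj g hg h hh i hi0 hip
      (mem_of_two_mul_mem (M := (R.traceIdeal I).toAddSubgroup) hkR heq)

end LieAlgebraModTraceIdeal

section Separation

variable {A B C : Type*} [CommRing A] [AddCommGroup B] [Module A B] [AddCommGroup C] [Module A C]
  {R : GMA A B C} [TopologicalSpace A] [IsTopologicalRing A]

theorem isClosed_setOf_mem_traceIdeal {Y : Type*} [TopologicalSpace Y] {X : Set R.Alg}
    (hX : Submodule.span A X = ⊤) {f : Y → R.Alg} (hf : ∀ x ∈ X, Continuous fun y => tr (x * f y))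
    {I : Ideal A} (hI : IsOpen (I : Set A)) : IsClosed {y | f y ∈ R.traceIdeal I} := by
  have hinter : {y | f y ∈ R.traceIdeal I} = ⋂ x ∈ X, (fun y => tr (x * f y)) ⁻¹' I := by
    ext y
    simp only [Set.mem_iInter, Set.mem_preimage, SetLike.mem_coe]
    exact ⟨fun h x _ => h x, mem_traceIdeal_of_span_eq_top hX⟩
  rw [hinter]
  exact isClosed_biInter fun x hx =>
    (AddSubgroup.isClosed_of_isOpen I.toAddSubgroup hI).preimage (hf x hx)

theorem exists_isOpen_ideal_notMem_traceIdeal [CompactSpace A] [T1Space A] {n : ℕ} [NeZero n]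
    [CharP A n] (h2 : IsUnit (2 : A)) (hR : R.IsFaithful) {Y : Type*} [TopologicalSpace Y]
    {X : Set R.Alg} (hX : Submodule.span A X = ⊤) {f : Y → R.Alg}
    (hf : ∀ x ∈ X, Continuous fun y => tr (x * f y)) {K : Set Y} (hK : IsCompact K)
    (hne : ∀ y ∈ K, f y ≠ 0) :
    ∃ I : Ideal A, IsOpen (I : Set A) ∧ ∀ y ∈ K, f y ∉ R.traceIdeal I := by
  let s := {I : Ideal A | IsOpen (I : Set A)}
  have hs : sInf s = ⊥ := by
    refine (Submodule.eq_bot_iff _).2 fun a ha => by_contra fun ha0 => ?_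
    obtain ⟨I, hI, haI⟩ := exists_isOpen_ideal_notMem (n := n) ha0
    exact haI (Submodule.mem_sInf.1 ha I hI)
  have _ : Nonempty s := ⟨⟨⊤, isOpen_univ⟩⟩
  obtain ⟨I, hI⟩ := hK.elim_directed_family_closed
    (fun I : s => {y | f y ∈ R.traceIdeal I})
    (fun I => isClosed_setOf_mem_traceIdeal hX hf I.2)
    (Set.eq_empty_of_forall_notMem fun y hy => hne y hy.1
      (eq_zero_of_forall_mem_traceIdeal h2 hR hs fun I hI => Set.mem_iInter.1 hy.2 ⟨I, hI⟩))
    fun I I' => ⟨⟨I ⊓ I', I.2.inter I'.2⟩, fun _ hy => traceIdeal_mono inf_le_left hy,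
      fun _ hy => traceIdeal_mono inf_le_right hy⟩
  exact ⟨I, I.2, fun y hy hyI => (hI ▸ ⟨hy, hyI⟩ : y ∈ (∅ : Set Y))⟩

end Separation

section Density

variable {p : ℕ} {PG F A B C : Type*} [Group PG] [Field F] [CommRing A] [Algebra F A]
  [AddCommGroup B] [Module A B] [AddCommGroup C] [Module A C] {R : GMA A B C}
  {ρ : PG →* R.Algˣ} {t : PG → A} {d : PG →* Aˣ}

theorem pinkTheta_sub_sub_nsmul_ne_zero [CharP F p] (hρ : IsTDRep t d R ρ) (l : A →ₗ[F] F)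
    {g₀ : PG} (hg₀ : tr (ρ g₀ : R.Alg) = 0) {x : R.Alg} (hlx : l (tr ((ρ g₀ : R.Alg) * x)) ≠ 0)
    {g h : PG} (hg : l (t (g₀ * g)) = 0) (hh : l (t (g₀ * h)) = 0) {i : ℕ} (hi0 : 0 < i)
    (hip : i < p) : pinkTheta F (ρ g : R.Alg) - pinkTheta F (ρ h : R.Alg) - i • x ≠ 0 := by
  intro hzero
  have hl : l (tr ((ρ g₀ : R.Alg) *
      (pinkTheta F (ρ g : R.Alg) - pinkTheta F (ρ h : R.Alg) - i • x))) = 0 := by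
    rw [hzero, mul_zero, tr_zero, map_zero]
  rw [mul_sub, mul_sub, tr_sub, tr_sub, tr_mul_pinkTheta hg₀, tr_mul_pinkTheta hg₀,
    ← Units.val_mul, ← Units.val_mul, ← map_mul, ← map_mul, hρ.tr_eq, hρ.tr_eq, map_sub, map_sub,
    hg, hh, sub_zero, zero_sub, neg_eq_zero, mul_smul_comm, tr_nsmul, map_nsmul,
    nsmul_eq_mul, mul_eq_zero, CharP.cast_eq_zero_iff F p] at hl
  exact hl.elim (Nat.not_dvd_of_pos_of_lt hi0 hip) hlx

variable [TopologicalSpace A]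

theorem exists_mem_pinkLie₂_of_mem_essentialSubmodule (l : A →ₗ[F] F) {a : A}
    (ha : a ∈ essentialSubmodule F ρ) (hla : l a ≠ 0) :
    ∃ g : PG, tr (ρ g : R.Alg) = 0 ∧ ∃ x ∈ pinkLie₂ F ρ, l (tr ((ρ g : R.Alg) * x)) ≠ 0 := by
  by_contra! hvanish
  refine hla (LinearMap.mem_ker.1 ((Submodule.span_le (p := LinearMap.ker l)).2 ?_ ha))
  rintro _ ⟨_, ⟨⟨g, rfl⟩, hg, -⟩, x, hx, rfl⟩
  exact hvanish g hg x hx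

variable [IsTopologicalRing A] [TopologicalSpace PG] [IsTopologicalGroup PG]

variable (F) in
theorem continuous_tr_mul_pinkTheta (ht : Continuous t) (hρ : IsTDRep t d R ρ) (g : PG) :
    Continuous fun h => tr ((ρ g : R.Alg) * pinkTheta F (ρ h : R.Alg)) := by
  simp_rw [pinkTheta, mul_sub, tr_sub, mul_smul_comm, tr_smul, mul_one, ← Units.val_mul,
    ← map_mul, hρ.tr_eq, Algebra.smul_def]
  fun_prop

variable [CompactSpace A] [T2Space A]

theorem exists_isOpen_ideal_pinkTheta_sub_notMem [NeZero p] [CharP A p]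
    (h2 : IsUnit (2 : A)) (ht : Continuous t) (hρ : IsTDRep t d R ρ) {x : R.Alg} {M : Set PG}
    (hM : IsCompact M)
    (hne : ∀ g ∈ M, ∀ h ∈ M, ∀ i, 0 < i → i < p →
      pinkTheta F (ρ g : R.Alg) - pinkTheta F (ρ h : R.Alg) - i • x ≠ 0) :
    ∃ I : Ideal A, IsOpen (I : Set A) ∧ ∀ g ∈ M, ∀ h ∈ M, ∀ i, 0 < i → i < p →
      pinkTheta F (ρ g : R.Alg) - pinkTheta F (ρ h : R.Alg) - i • x ∉ R.traceIdeal I := by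
  have hcont : ∀ y ∈ Set.range fun g => (ρ g : R.Alg), Continuous fun z : PG × PG × ℕ =>
      tr (y * (pinkTheta F (ρ z.1 : R.Alg) - pinkTheta F (ρ z.2.1 : R.Alg) - z.2.2 • x)) := by
    rintro _ ⟨g, rfl⟩
    have hθ := continuous_tr_mul_pinkTheta F ht hρ g
    simp only [mul_sub, tr_sub, mul_smul_comm, tr_nsmul]
    exact ((hθ.comp continuous_fst).sub (hθ.comp (continuous_fst.comp continuous_snd))).sub
      ((continuous_of_discreteTopology (f := fun i : ℕ => i • tr ((ρ g : R.Alg) * x))).comp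
        (continuous_snd.comp continuous_snd))
  obtain ⟨I, hI, hnotMem⟩ := exists_isOpen_ideal_notMem_traceIdeal (n := p) h2 hρ.faithful
    hρ.span_eq_top hcont (hM.prod (hM.prod (Set.finite_Ioo 0 p).isCompact))
    fun z hz => hne z.1 hz.1 z.2.1 hz.2.1 z.2.2 hz.2.2.1 hz.2.2.2
  exact ⟨I, hI, fun g hg h hh i hi0 hip => hnotMem (g, h, i) ⟨hg, hh, hi0, hip⟩⟩

variable [Finite (MaximalSpectrum A)] [CompactSpace PG]

theorem isOpen_ker_reduction_jacobson (h2 : IsUnit (2 : A)) (ht : Continuous t)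
    (hρ : IsTDRep t d R ρ) : IsOpen ((reduction ρ (Ring.jacobson R.Alg)).ker : Set PG) :=
  Subgroup.isOpen_mono (ker_reduction_mono (traceIdeal_jacobson_le h2))
    (isOpen_ker_reduction ht hρ isOpen_jacobson)

variable [MeasurableSpace PG] [BorelSpace PG] {μ : Measure PG} [μ.IsMulLeftInvariant]
  [CharP F p]

theorem mul_measure_le_measure_ker_of_isCompact (hp : Odd p) (ht : Continuous t)
    (hd : ∀ g, (d g : A) ∈ Set.range (algebraMap F A)) (hρ : IsTDRep t d R ρ) (l : A →ₗ[F] F)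
    {g₀ : PG} (hg₀ : tr (ρ g₀ : R.Alg) = 0) {x : R.Alg} (hx : x ∈ pinkLie₂ F ρ)
    (hlx : l (tr ((ρ g₀ : R.Alg) * x)) ≠ 0) {M : Set PG} (hMc : IsCompact M)
    (hM : M ⊆ (reduction ρ (Ring.jacobson R.Alg)).ker) (hlM : ∀ g ∈ M, l (t (g₀ * g)) = 0) :
    p * μ M ≤ μ (reduction ρ (Ring.jacobson R.Alg)).ker := by
  have _ : Nontrivial A := nontrivial_of_ne (tr ((ρ g₀ : R.Alg) * x)) 0 fun h =>
    hlx (by rw [h, map_zero])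
  have _ : NeZero p := ⟨hp.pos.ne'⟩
  have _ : CharP A p := charP_of_injective_algebraMap (algebraMap F A).injective p
  obtain ⟨k, hk⟩ := exists_two_mul_natCast_eq_one hp F
  have h2 : IsUnit (2 : A) :=
    IsUnit.of_mul_eq_one _ (two_mul_natCast_eq_one_of_ringHom (algebraMap F A) hk)
  obtain ⟨I, hI, hsep⟩ := exists_isOpen_ideal_pinkTheta_sub_notMem (F := F) h2 ht hρ hMc
    fun g hg h hh _ => pinkTheta_sub_sub_nsmul_ne_zero hρ l hg₀ hlx (hlM g hg) (hlM h hh)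
  let I' := I ⊓ Ring.jacobson A
  have hI' : IsOpen (I' : Set A) := hI.inter isOpen_jacobson
  have _ := finite_quotient_traceIdeal ht hρ hI'
  have hker : (reduction ρ (R.traceIdeal I')).ker ≤ (reduction ρ (Ring.jacobson R.Alg)).ker :=
    ker_reduction_mono ((traceIdeal_mono inf_le_right).trans (traceIdeal_jacobson_le h2))
  have hdet : ∀ g ∈ (reduction ρ (Ring.jacobson R.Alg)).ker, det (ρ g : R.Alg) = 1 := fun g hg =>
    det_eq_one_of_sub_one_mem_jacobson (mem_ker_reduction.1 hg) (hρ.det_eq g ▸ hd g)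
  exact mul_measure_le_of_mul_ncard_image_le (isOpen_ker_reduction ht hρ hI') hker
    (mul_ncard_image_reduction_le hk hdet hI' hx hM fun g hg h hh i hi0 hip hmem =>
      hsep g hg h hh i hi0 hip (traceIdeal_mono inf_le_left hmem))

end Density

end GMA

theorem mainTheorem6_general {p : ℕ} (hp : Odd p)
    {F : Type*} [Field F] [CharP F p]
    {A : Type*} [CommRing A] [TopologicalSpace A] [IsTopologicalRing A]
    [CompactSpace A] [T2Space A] [Algebra F A] [Finite (MaximalSpectrum A)]
    {PG : Type*} [Group PG] [TopologicalSpace PG] [IsTopologicalGroup PG] [CompactSpace PG]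
    [MeasurableSpace PG] [BorelSpace PG] {t : PG → A} {d : PG →* Aˣ}
    (ht : Continuous t) (hd : ∀ g, (d g : A) ∈ Set.range (algebraMap F A))
    {B C : Type*} [AddCommGroup B] [Module A B] [AddCommGroup C] [Module A C]
    {R : GMA A B C} {ρ : PG →* R.Algˣ} (hρ : IsTDRep t d R ρ) (l : A →ₗ[F] F)
    {g₀ : PG} (hg₀ : GMA.tr (ρ g₀ : R.Alg) = 0) {x : R.Alg} (hx : x ∈ GMA.pinkLie₂ F ρ)
    (hlx : l (GMA.tr ((ρ g₀ : R.Alg) * x)) ≠ 0) :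
    Finite (GMA.residualImage ρ) ∧
      ((p : ℝ) - 1) / ((p : ℝ) * (Nat.card (GMA.residualImage ρ) : ℝ)) ≤
        (Measure.haarMeasure (⊤ : PositiveCompacts PG)).real {g : PG | l (t g) ≠ 0} := by
  obtain ⟨k, hk⟩ := exists_two_mul_natCast_eq_one hp F
  have h2 : IsUnit (2 : A) :=
    IsUnit.of_mul_eq_one _ (two_mul_natCast_eq_one_of_ringHom (algebraMap F A) hk)
  rw [GMA.residualImage_eq_range]
  set φ := GMA.reduction ρ (Ring.jacobson R.Alg)
  set μ := Measure.haarMeasure (⊤ : PositiveCompacts PG)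
  have hopen : IsOpen (φ.ker : Set PG) := GMA.isOpen_ker_reduction_jacobson h2 ht hρ
  have hcard : Nat.card φ.range * μ.real φ.ker = 1 := by
    have huniv : μ Set.univ = 1 := Measure.haarMeasure_self (K₀ := ⊤)
    simpa [huniv, Measure.real] using
      congrArg ENNReal.toReal (natCard_range_mul_measure_ker (μ := μ) hopen)
  have hle : μ.real φ.ker ≤ μ.real φ.ker / p + μ.real {g | l (t (g₀ * g)) ≠ 0} :=
    measureReal_le_div_add_of_forall_isCompact hopen.measurableSet hp.pos.ne' fun M hM hMc =>
      GMA.mul_measure_le_measure_ker_of_isCompact hp ht hd hρ l hg₀ hx hlx hMc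
        (hM.trans Set.sdiff_subset) fun g hg => not_not.1 (hM hg).2
  have htranslate : μ.real {g | l (t (g₀ * g)) ≠ 0} = μ.real {g | l (t g) ≠ 0} :=
    congrArg ENNReal.toReal (measure_preimage_mul μ g₀ {g | l (t g) ≠ 0})
  have hn : (Nat.card φ.range : ℝ) ≠ 0 := left_ne_zero_of_mul_eq_one hcard
  rw [htranslate, eq_inv_of_mul_eq_one_right hcard] at hle
  refine ⟨finite_range_of_isOpen_ker hopen, ?_⟩
  calc ((p : ℝ) - 1) / (p * Nat.card φ.range)
      = (Nat.card φ.range : ℝ)⁻¹ - (Nat.card φ.range : ℝ)⁻¹ / p := by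
        have : (p : ℝ) ≠ 0 := Nat.cast_ne_zero.2 hp.pos.ne'
        field_simp
    _ ≤ μ.real {g | l (t g) ≠ 0} := sub_le_iff_le_add'.2 hle

theorem mainTheorem6 {p : ℕ} [Fact p.Prime] (hp : 2 < p)
    {F : Type*} [Field F] [Finite F] [CharP F p] [TopologicalSpace F] [DiscreteTopology F]
    {A : Type*} [CommRing A] [TopologicalSpace A] [IsTopologicalRing A]
    [CompactSpace A] [T2Space A] [Algebra F A] (hA : IsSemilocalWithResidueField F A)
    {PG : Type*} [Group PG] [TopologicalSpace PG] [IsTopologicalGroup PG] [CompactSpace PG]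
    [T2Space PG] [TotallyDisconnectedSpace PG] [MeasurableSpace PG] [BorelSpace PG]
    (ρbar : MaximalSpectrum A → (PG →* GL (Fin 2) F)) (t : PG → A) (d : PG →* Aˣ)
    (hadm : IsAdmissiblePseudoDeformation p ρbar t d)
    {B C : Type*} [AddCommGroup B] [Module A B] [AddCommGroup C] [Module A C]
    (R : GMA A B C) (ρ : PG →* R.Algˣ) (hρ : IsTDRep t d R ρ)
    (hodd : GMA.IsWeaklyOdd ρ)
    (l : A →ₗ[F] F) (hl : ∃ a ∈ GMA.essentialSubmodule F ρ, l a ≠ 0) :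
    Finite (GMA.residualImage ρ) ∧
      ((p : ℝ) - 1) / ((p : ℝ) * (Nat.card (GMA.residualImage ρ) : ℝ)) ≤
        (Measure.haarMeasure (⊤ : PositiveCompacts PG)).real {g : PG | l (t g) ≠ 0} := by
  have _ := hA.semilocal
  obtain ⟨_, ha, hla⟩ := hl
  obtain ⟨g₀, hg₀, x, hx, hlx⟩ := GMA.exists_mem_pinkLie₂_of_mem_essentialSubmodule l ha hla
  exact mainTheorem6_general ((Fact.out : p.Prime).odd_of_ne_two hp.ne') hadm.continuous_t
    hadm.constant_det hρ l hg₀ hx hlx
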